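/- **Theorem 1.** Let $n,p,k,z\in\mathbb N$ with $n$ and $z$ even and $1\le z\le n-1$, let $\sigma>0$, let $q=(q_1,\dots,q_p)\in(0,1]^p$, and let $\mu^{(1)},\mu^{(2)}\in\mathbb R^p$ be such that $\theta:=\mu^{(2)}-\mu^{(1)}\ne 0$ has at most $k$ non-zero coordinates. Put $\tau:=n^{-1}\min(z,n-z)$ and $\|\theta\|_{2,q}:=\bigl(\sum_{j=1}^p\theta_j^2q_j\bigr)^{1/2}$. *Model.* Let $X=(X_{j,t})\in\mathbb R^{p\times n}$ have independent columns $X_t\sim N_p(\mu_t,\sigma^2I_p)$, where $\mu_t=\mu^{(1)}$ for $t\le z$ and $\mu_t=\mu^{(2)}$ for $t>z$. Independently of $X$, let $\Omega=(\omega_{j,t})\in\{0,1\}^{p\times n}$ have independent entries with $\omega_{j,t}\sim\mathrm{Bern}(q_j)$. The entrywise product is written $X\circ\Omega$. *MissCUSUM transformation.* For $M\in\mathbb R^{p\times m}$ and $\Omega\in\{0,1\}^{p\times m}$ write $L_{j,t}:=\sum_{r=1}^t\omega_{j,r}$, $R_{j,t}:=\sum_{r=m-t+1}^m\omega_{j,r}$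 and $N_j:=L_{j,m}$. Then $\mathcal T^{\mathrm{Miss}}(M,\Omega)\in\mathbb R^{p\times(m-1)}$ has $(j,t)$ entry $$\sqrt{\frac{L_{j,t}R_{j,m-t}}{N_j}}\Bigl(\frac1{R_{j,m-t}}\sum_{r=t+1}^m(M\circ\Omega)_{j,r}-\frac1{L_{j,t}}\sum_{r=1}^t(M\circ\Omega)_{j,r}\Bigr)$$ if $L_{j,t}>0$ and $R_{j,m-t}>0$, and $0$ otherwise. *Estimator.* Let $n_1:=n/2$ and $\lambda:=2\sigma\sqrt{n\log(pn)}$. Let $T^{(1)}$ and $T^{(2)}$ in $\mathbb R^{p\times(n_1-1)}$ be the MissCUSUM transformations of the pairs formed by the odd-numbered and by the even-numbered columns of $(X\circ\Omega,\Omega)$, respectively. Let $(\hat v,\hat w)$ be a maximiser of $$(v,w)\mapsto\langle T^{(1)},vw^\top\rangle-\lambda\|v\|_1$$ over $\|v\|_2\le1$, $\|w\|_2\le1$ ($v\in\mathbb R^p$, $w\in\mathbb R^{n_1-1}$), chosen as a function of $T^{(1)}$ so that $\hat v$ is a measurable function of $T^{(1)}$. Finally let $$\hat z:=2\,\mathrm{median}\Bigl(\operatorname*{argmax}_{1\le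 t\le n_1-1}\bigl|(\hat v^\top T^{(2)})_t\bigr|\Bigr),$$ where the median of a finite set of even size is the average of its two middle elements. *Claim.* There exist universal constants $C,C'>0$ (not depending on $n,p,k,z,\mu^{(1)},\mu^{(2)},\sigma,q$ or on the choice of maximiser) such that whenever $$\frac{C'}{\tau}\sqrt{\frac{\log(pn)}n}\Bigl(\frac{\sigma\sqrt k}{\|\theta\|_{2,q}}+\frac{\|\theta\|_2}{\|\theta\|_{2,q}}\Bigr)\le\frac12,$$ we have $$\mathbb P\Bigl\{\frac{|\hat z-z|}{n\tau}>C\sqrt{\frac{\log(kn)}{n\tau}}\Bigl(\frac{\sigma}{\|\theta\|_{2,q}}+\frac{\|\theta\|_2}{\|\theta\|_{2,q}}\Bigr)\Bigr\}\le\frac{22}n.$$ -/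

import Mathlib

open MeasureTheory ProbabilityTheory

noncomputable section

namespace MissInspect

/-! Time points `1, …, n` are represented by `Fin n`: the element `r : Fin n` is time `r + 1`.
Likewise the column `i : Fin (n - 1)` of a CUSUM matrix is the one for the split after `t = i + 1`.
A revelation matrix has entries in `Bool`, with `true` for an observed entry. -/

/-! ### The data-generating mechanism -/

/-- The mean matrix: column `r` is `μ₁` for times `≤ z` and `μ₂` for times `> z`. -/
def meanMatrix {p : ℕ} (n z : ℕ) (μ₁ μ₂ : EuclideanSpace ℝ (Fin p)) :
    Fin p → Fin n → ℝ :=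
  fun j r => if r.val + 1 ≤ z then μ₁ j else μ₂ j

/-- The joint law of the data matrix and the revelation matrix: the two are independent, the
columns of the data matrix are independent `N(mean, σ² I)`, and the entries of the revelation
matrix are independent, those in row `j` being Bernoulli with parameter `q j`. -/
def changepointLaw {p : ℕ} (n z : ℕ) (μ₁ μ₂ : EuclideanSpace ℝ (Fin p)) (σ : ℝ)
    (q : Fin p → unitInterval) : Measure ((Fin p → Fin n → ℝ) × (Fin p → Fin n → Bool)) :=
  (Measure.pi fun j => Measure.pi fun r =>
      gaussianReal (meanMatrix n z μ₁ μ₂ j r) (Real.toNNReal (σ ^ 2))).prod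
    (Measure.pi fun j => Measure.pi fun _ => bernoulliMeasure true false (q j))

/-- The number of coordinates in which the vector `u` is non-zero. -/
def sparsity {p : ℕ} (u : EuclideanSpace ℝ (Fin p)) : ℕ :=
  (Finset.univ.filter fun j => u j ≠ 0).card

/-- The weighted Euclidean norm `(∑ j, u_j² q_j)^{1/2}`. -/
def weightedNorm {p : ℕ} (q : Fin p → unitInterval) (u : EuclideanSpace ℝ (Fin p)) : ℝ :=
  Real.sqrt (∑ j, u j ^ 2 * (q j : ℝ))

/-- The relative distance `τ = n⁻¹ min(z, n - z)` of the changepoint to the boundary. -/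
def boundaryDist (n z : ℕ) : ℝ := min (z : ℝ) ((n : ℝ) - z) / n

/-! ### The MissCUSUM transformation -/

/-- The entrywise product of a data matrix with a revelation matrix. -/
def mask {p n : ℕ} (M : Fin p → Fin n → ℝ) (W : Fin p → Fin n → Bool) : Fin p → Fin n → ℝ :=
  fun j r => if W j r then M j r else 0

/-- The number of observations in row `j` among the first `t` time points. -/
def leftCount {p n : ℕ} (W : Fin p → Fin n → Bool) (j : Fin p) (t : ℕ) : ℕ :=
  (Finset.univ.filter fun r : Fin n => r.val + 1 ≤ t ∧ W j r).card

/-- The number of observations in row `j` among the last `t` time points. -/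
def rightCount {p n : ℕ} (W : Fin p → Fin n → Bool) (j : Fin p) (t : ℕ) : ℕ :=
  (Finset.univ.filter fun r : Fin n => n + 1 ≤ r.val + 1 + t ∧ W j r).card

/-- The entry of the MissCUSUM transformation in row `j` for the split after time `t`. -/
def missCusumAt {p n : ℕ} (M : Fin p → Fin n → ℝ) (W : Fin p → Fin n → Bool)
    (j : Fin p) (t : ℕ) : ℝ :=
  if 0 < leftCount W j t ∧ 0 < rightCount W j (n - t) then
    Real.sqrt ((leftCount W j t : ℝ) * rightCount W j (n - t) / leftCount W j n) *
      (1 / (rightCount W j (n - t) : ℝ) *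
          (∑ r ∈ Finset.univ.filter fun r : Fin n => t + 1 ≤ r.val + 1, mask M W j r) -
        1 / (leftCount W j t : ℝ) *
          (∑ r ∈ Finset.univ.filter fun r : Fin n => r.val + 1 ≤ t, mask M W j r))
  else 0

/-- The MissCUSUM transformation. -/
def missCusum {p n : ℕ} (M : Fin p → Fin n → ℝ) (W : Fin p → Fin n → Bool) :
    Fin p → Fin (n - 1) → ℝ :=
  fun j i => missCusumAt M W j (i.val + 1)

/-! ### The sample-splitting algorithm -/

/-- The first `⌊n / 2⌋` odd-numbered columns (times `1, 3, 5, …`). -/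
def oddColumns {α : Type*} {p n : ℕ} (M : Fin p → Fin n → α) : Fin p → Fin (n / 2) → α :=
  fun j i => M j ⟨2 * i.val, by omega⟩

/-- The `⌊n / 2⌋` even-numbered columns (times `2, 4, 6, …`). -/
def evenColumns {α : Type*} {p n : ℕ} (M : Fin p → Fin n → α) : Fin p → Fin (n / 2) → α :=
  fun j i => M j ⟨2 * i.val + 1, by omega⟩

/-- The penalised objective `⟨T, v wᵀ⟩ - lam * ‖v‖₁` at the pair `(v, w)`. -/
def objective {p m : ℕ} (lam : ℝ) (T : Fin p → Fin m → ℝ)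
    (vw : EuclideanSpace ℝ (Fin p) × EuclideanSpace ℝ (Fin m)) : ℝ :=
  (∑ j, ∑ i, T j i * (vw.1 j * vw.2 i)) - lam * ∑ j, |vw.1 j|

/-- The set of maximisers of the objective over pairs of vectors in the closed unit balls. -/
def argmaxSet {p m : ℕ} (lam : ℝ) (T : Fin p → Fin m → ℝ) :
    Set (EuclideanSpace ℝ (Fin p) × EuclideanSpace ℝ (Fin m)) :=
  {vw | vw ∈ Metric.closedBall 0 1 ×ˢ Metric.closedBall 0 1 ∧
    IsMaxOn (objective lam T) (Metric.closedBall 0 1 ×ˢ Metric.closedBall 0 1) vw}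

/-- The projected series `vᵀ T`. -/
def project {p m : ℕ} (v : EuclideanSpace ℝ (Fin p)) (T : Fin p → Fin m → ℝ) : Fin m → ℝ :=
  fun i => ∑ j, v j * T j i

/-- The set of locations `t ∈ {1, …, m}` at which a series is largest in absolute value. -/
def peakSet {m : ℕ} (f : Fin m → ℝ) : Finset ℕ :=
  (Finset.univ.filter fun i => ∀ i', |f i'| ≤ |f i|).image fun i => i.val + 1

/-- The median of a non-empty finite set: the average of the two middle elements, which coincide
when the number of elements is odd. -/
def median (s : Finset ℕ) : ℝ :=
  (((s.sort).getD ((s.card - 1) / 2) 0 : ℝ) + ((s.sort).getD (s.card / 2) 0 : ℝ)) / 2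

/-- The output of the sample-splitting algorithm on the masked data `Y` and the revelation
matrix `W`, when the optimisation problem for the matrix `T` is solved by the pair `opt T`. -/
def splitEstimator {p n : ℕ}
    (opt : (Fin p → Fin (n / 2 - 1) → ℝ) →
      EuclideanSpace ℝ (Fin p) × EuclideanSpace ℝ (Fin (n / 2 - 1)))
    (Y : Fin p → Fin n → ℝ) (W : Fin p → Fin n → Bool) : ℝ :=
  2 * median (peakSet (project (opt (missCusum (oddColumns Y) (oddColumns W))).1
    (missCusum (evenColumns Y) (evenColumns W))))

end MissInspect

end

/-! Given the revelation matrix, the MissCUSUM transformation is linear in the data. Its weights sum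
to zero and have Euclidean norm at most one (`sum_cusumCoef`, `sum_cusumCoef_sq_le`). Each entry is
therefore a mean plus a Gaussian of variance at most `σ ^ 2`, and the mean depends only on the jump
`θ j` and on a few counts.

As a function of the square roots of those counts, the mean is `θ j` times a curve that is
homogeneous of degree one and Lipschitz with constant 5 (`abs_cusumShape_sub_le`). The square root
stabilises the variance: each root of a count is within `x` of the root of its expectation except
with probability `2 * exp (-x ^ 2)`, whatever `q j` is (`sqrt_count_tail`). So, up to errors `5 * x
* |θ j|`, the mean is the rank-one matrix with factors `u j = θ j * √(q j)` and `cusumCurve`. Here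
`‖u‖` is the weighted norm, and the errors paired with a unit vector cost only `‖θ‖`; this is the
source of the term `‖θ‖ / weightedNorm q θ`.

In the odd half, the penalty absorbs the noise, since the noise in the bilinear form is at most `lam
* ‖v‖₁` uniformly. Comparing the maximiser with the normalised signal pair shows that the direction
has correlation `β` with `u`, where `|β|` is at least half the weighted norm
(`alignment_of_mem_argmaxSet`).

In the even half, the direction is independent of the noise, so each projected entry has a
one-dimensional Gaussian tail, with no union over rows. The projected series is `β` times the curve
plus a small error. The curve falls at least linearly away from `z` near its peak
(`cusumCurve_drop`), which bounds the distance of every peak from `z`, hence that of their median.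
`abs_median_peakSet_project_sub_le` gathers this deterministic part; union bounds control the
exceptional events. -/

namespace MissInspect

/-! ### Splitting a product law into odd and even columns -/

/-- Interleaving of two copies of `Fin (n / 2)` as the even and odd elements of `Fin n`. -/
noncomputable def interleave {n : ℕ} (hn : Even n) : Fin (n / 2) ⊕ Fin (n / 2) ≃ Fin n :=
  Equiv.ofBijective
    (Sum.elim (fun i => (⟨2 * i.val, by omega⟩ : Fin n)) fun i => ⟨2 * i.val + 1, by omega⟩) (by
    have hn' : n % 2 = 0 := Nat.even_iff.mp hn
    constructor
    · rintro (a | a) (b | b) h <;> simp [Fin.ext_iff] at h ⊢ <;> omega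
    · intro r
      rcases Nat.even_or_odd r.val with h | h
      · have := Nat.even_iff.mp h
        exact ⟨Sum.inl ⟨r.val / 2, by omega⟩, by simp [Fin.ext_iff]; omega⟩
      · have := Nat.odd_iff.mp h
        exact ⟨Sum.inr ⟨r.val / 2, by omega⟩, by simp [Fin.ext_iff]; omega⟩)

theorem measurePreserving_split_row {α : Type*} [MeasurableSpace α] {n : ℕ} (hn : Even n)
    (ν : Fin n → Measure α) [∀ r, IsProbabilityMeasure (ν r)] :
    MeasurePreserving
      (fun x : Fin n → α => ((fun i : Fin (n / 2) => x ⟨2 * i.val, by omega⟩),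
        fun i : Fin (n / 2) => x ⟨2 * i.val + 1, by omega⟩))
      (Measure.pi ν)
      ((Measure.pi fun i : Fin (n / 2) => ν ⟨2 * i.val, by omega⟩).prod
        (Measure.pi fun i : Fin (n / 2) => ν ⟨2 * i.val + 1, by omega⟩)) := by
  have h1 := (measurePreserving_piCongrLeft (α := fun _ : Fin n => α) ν (interleave hn)).symm
  have h2 := measurePreserving_sumPiEquivProdPi
    (X := fun _ : Fin (n / 2) ⊕ Fin (n / 2) => α) (fun i => ν (interleave hn i))
  exact h2.comp h1

theorem measurePreserving_split {α : Type*} [MeasurableSpace α] {p n : ℕ} (hn : Even n)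
    (ν : Fin p → Fin n → Measure α) [∀ j r, IsProbabilityMeasure (ν j r)] :
    MeasurePreserving (fun x : Fin p → Fin n → α => (oddColumns x, evenColumns x))
      (Measure.pi fun j => Measure.pi (ν j))
      ((Measure.pi fun j => Measure.pi (oddColumns ν j)).prod
        (Measure.pi fun j => Measure.pi (evenColumns ν j))) := by
  have h1 := measurePreserving_pi (fun j => Measure.pi (ν j)) _
    (fun j => measurePreserving_split_row hn (ν j))
  have h2 := measurePreserving_arrowProdEquivProdArrow (Fin (n / 2) → α) (Fin (n / 2) → α) (Fin p)
    (fun j => Measure.pi fun i : Fin (n / 2) => ν j ⟨2 * i.val, by omega⟩)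
    (fun j => Measure.pi fun i : Fin (n / 2) => ν j ⟨2 * i.val + 1, by omega⟩)
  exact h2.comp h1

/-! ### Slicing bounds for product measures -/

/-- Conditioning on an independent factor: it may be frozen at any value, provided the bound on the
slice is uniform. -/
theorem prod_apply_le_of_forall_fst {α β : Type*} [MeasurableSpace α] [MeasurableSpace β]
    (μ : Measure α) [IsProbabilityMeasure μ] (ν : Measure β) [IsProbabilityMeasure ν]
    {s : Set (α × β)} (hs : MeasurableSet s) {c : ENNReal}
    (h : ∀ a, ν {b | (a, b) ∈ s} ≤ c) : μ.prod ν s ≤ c := by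
  rw [Measure.prod_apply hs]
  calc ∫⁻ a, ν (Prod.mk a ⁻¹' s) ∂μ ≤ ∫⁻ _, c ∂μ := lintegral_mono h
    _ = c := by simp

theorem prod_apply_le_of_forall_snd {α β : Type*} [MeasurableSpace α] [MeasurableSpace β]
    (μ : Measure α) [IsProbabilityMeasure μ] (ν : Measure β) [IsProbabilityMeasure ν]
    {s : Set (α × β)} (hs : MeasurableSet s) {c : ENNReal}
    (h : ∀ b, μ {a | (a, b) ∈ s} ≤ c) : μ.prod ν s ≤ c := by
  rw [Measure.prod_apply_symm hs]
  calc ∫⁻ b, μ ((fun a => (a, b)) ⁻¹' s) ∂ν ≤ ∫⁻ _, c ∂ν := lintegral_mono h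
    _ = c := by simp

/-! ### Exponential bounds -/

theorem measure_le_exp_mul_integral {α : Type*} [MeasurableSpace α] (μ : Measure α)
    [IsProbabilityMeasure μ] {f : α → ℝ} (a : ℝ) (hf : Integrable (fun x => Real.exp (f x)) μ) :
    μ {x | a ≤ f x} ≤ ENNReal.ofReal (Real.exp (-a) * ∫ x, Real.exp (f x) ∂μ) := by
  have h := mul_meas_ge_le_integral_of_nonneg (μ := μ) (f := fun x => Real.exp (f x))
    (Filter.Eventually.of_forall fun x => (Real.exp_pos _).le) hf (Real.exp a)
  have h2 : μ {x | a ≤ f x} = ENNReal.ofReal (μ.real {x | Real.exp a ≤ Real.exp (f x)}) := by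
    simp [measureReal_def]
  rw [h2]
  apply ENNReal.ofReal_le_ofReal
  rw [Real.exp_neg, ← div_eq_inv_mul, le_div_iff₀ (Real.exp_pos a), mul_comm]
  exact h

/-- The centred exponential moment of a linear functional of a matrix of independent normals. -/
theorem integral_exp_linear_gaussian {p m : ℕ} (a c : Fin p → Fin m → ℝ) (v : NNReal) :
    Integrable (fun x : Fin p → Fin m → ℝ => Real.exp (∑ j, ∑ r, c j r * (x j r - a j r)))
        (Measure.pi fun j => Measure.pi fun r => gaussianReal (a j r) v) ∧
      ∫ x, Real.exp (∑ j, ∑ r, c j r * (x j r - a j r))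
          ∂(Measure.pi fun j => Measure.pi fun r => gaussianReal (a j r) v) =
        Real.exp (v * (∑ j, ∑ r, c j r ^ 2) / 2) := by
  have hentry : ∀ j r, (fun x : ℝ => Real.exp (c j r * (x - a j r))) =
      fun x => Real.exp (-(c j r * a j r)) * Real.exp (c j r * x) := by
    intro j r; ext x; rw [← Real.exp_add]; ring_nf
  have hint : ∀ j r, Integrable (fun x : ℝ => Real.exp (c j r * (x - a j r)))
      (gaussianReal (a j r) v) := by
    intro j r
    rw [hentry]
    exact (integrable_exp_mul_gaussianReal (c j r)).const_mul _
  have hval : ∀ j r, ∫ x, Real.exp (c j r * (x - a j r)) ∂(gaussianReal (a j r) v) =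
      Real.exp (v * c j r ^ 2 / 2) := by
    intro j r
    rw [hentry, integral_const_mul]
    have := congrFun (mgf_fun_id_gaussianReal (μ := a j r) (v := v)) (c j r)
    rw [mgf] at this
    rw [this, ← Real.exp_add]
    ring_nf
  simp only [Real.exp_sum]
  have hrow : ∀ j, Integrable (fun x : Fin m → ℝ => ∏ r, Real.exp (c j r * (x r - a j r)))
      (Measure.pi fun r => gaussianReal (a j r) v) := fun j => Integrable.fintype_prod (hint j)
  refine ⟨Integrable.fintype_prod hrow, ?_⟩
  rw [integral_fintype_prod_eq_prod
    (fun j (x : Fin m → ℝ) => ∏ r, Real.exp (c j r * (x r - a j r)))]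
  have : ∀ j, ∫ x : Fin m → ℝ, ∏ r, Real.exp (c j r * (x r - a j r))
      ∂(Measure.pi fun r => gaussianReal (a j r) v) = ∏ r, Real.exp (v * c j r ^ 2 / 2) := by
    intro j
    rw [integral_fintype_prod_eq_prod (fun r (x : ℝ) => Real.exp (c j r * (x - a j r)))]
    exact Finset.prod_congr rfl fun r _ => hval j r
  rw [Finset.prod_congr rfl fun j _ => this j]
  simp only [← Real.exp_sum, Finset.mul_sum, Finset.sum_div]

theorem gaussian_linear_upper_tail {p m : ℕ} (a c : Fin p → Fin m → ℝ) {σ y : ℝ} (hσ : 0 < σ)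
    (hy : 0 < y)     (hc : ∑ j, ∑ r, c j r ^ 2 ≤ 1) :
    (Measure.pi fun j => Measure.pi fun r => gaussianReal (a j r) (Real.toNNReal (σ ^ 2)))
        {x | σ * y ≤ ∑ j, ∑ r, c j r * (x j r - a j r)} ≤
      ENNReal.ofReal (Real.exp (-(y ^ 2 / 2))) := by
  -- The tilt `y / σ` is the optimal one; the exponent becomes `-y ^ 2 + y ^ 2 / 2`.
  obtain ⟨hint, hval⟩ := integral_exp_linear_gaussian a (fun j r => y / σ * c j r)
    (Real.toNNReal (σ ^ 2))
  have hset : {x : Fin p → Fin m → ℝ | σ * y ≤ ∑ j, ∑ r, c j r * (x j r - a j r)} =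
      {x | y ^ 2 ≤ ∑ j, ∑ r, y / σ * c j r * (x j r - a j r)} := by
    ext x
    simp only [Set.mem_ofPred_eq, mul_assoc, ← Finset.mul_sum]
    rw [div_mul_eq_mul_div, le_div_iff₀ hσ, pow_two, mul_assoc, mul_le_mul_iff_right₀ hy, mul_comm]
  rw [hset]
  refine (measure_le_exp_mul_integral _ _ hint).trans (ENNReal.ofReal_le_ofReal ?_)
  rw [hval, ← Real.exp_add, Real.exp_le_exp, Real.coe_toNNReal _ (sq_nonneg σ)]
  have : ∑ j, ∑ r, (y / σ * c j r) ^ 2 = (y / σ) ^ 2 * ∑ j, ∑ r, c j r ^ 2 := by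
    simp only [mul_pow, Finset.mul_sum]
  rw [this, ← mul_assoc, ← mul_pow, mul_div_cancel₀ _ hσ.ne']
  nlinarith [sq_nonneg y]

theorem gaussian_linear_tail {p m : ℕ} (a c : Fin p → Fin m → ℝ) {σ y : ℝ} (hσ : 0 < σ)
    (hy : 0 < y) (hc : ∑ j, ∑ r, c j r ^ 2 ≤ 1) :
    (Measure.pi fun j => Measure.pi fun r => gaussianReal (a j r) (Real.toNNReal (σ ^ 2)))
        {x | σ * y < |∑ j, ∑ r, c j r * (x j r - a j r)|} ≤
      ENNReal.ofReal (2 * Real.exp (-(y ^ 2 / 2))) := by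
  have h1 := gaussian_linear_upper_tail a c hσ hy hc
  have h2 := gaussian_linear_upper_tail a (fun j r => -c j r) hσ hy (by simpa using hc)
  rw [two_mul, ENNReal.ofReal_add (Real.exp_pos _).le (Real.exp_pos _).le]
  refine le_trans (measure_mono ?_) ((measure_union_le _ _).trans (add_le_add h1 h2))
  intro x hx
  have hx' : σ * y < |∑ j, ∑ r, c j r * (x j r - a j r)| := hx
  rcases lt_abs.mp hx' with h | h
  · exact Or.inl h.le
  · refine Or.inr ?_
    simpa only [Set.mem_ofPred_eq, neg_mul, Finset.sum_neg_distrib] using h.le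

/-! ### Square-root deviation bound for the number of successes -/

/-- The binomial exponential moment is dominated by the Poisson one of the same mean, through `1 + x
≤ exp x` in each factor. -/
theorem integral_exp_count_le {m : ℕ} (q : unitInterval) (S : Finset (Fin m)) (s : ℝ) :
    ∫ w : Fin m → Bool, Real.exp (s * (S.filter fun r => w r).card)
        ∂(Measure.pi fun _ => bernoulliMeasure true false q) ≤
      Real.exp (q * S.card * (Real.exp s - 1)) := by
  have hexp : ∀ w : Fin m → Bool, Real.exp (s * (S.filter fun r => w r).card) =
      ∏ r, if r ∈ S then Real.exp (if w r then s else 0) else 1 := by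
    intro w
    rw [Finset.prod_ite_mem, Finset.univ_inter, ← Real.exp_sum, ← Finset.sum_filter,
      Finset.sum_const, nsmul_eq_mul, mul_comm]
  simp only [hexp]
  rw [integral_fintype_prod_eq_prod
    (fun r (b : Bool) => if r ∈ S then Real.exp (if b then s else 0) else 1)]
  have hfac : ∀ r, ∫ b : Bool, (if r ∈ S then Real.exp (if b then s else 0) else 1)
      ∂(bernoulliMeasure true false q) = if r ∈ S then 1 + q * (Real.exp s - 1) else 1 := by
    intro r
    by_cases h : r ∈ S
    · simp only [h, if_true]
      rw [integral_bernoulliMeasure]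
      simp
      ring
    · simp [h]
  rw [Finset.prod_congr rfl fun r _ => hfac r, Finset.prod_ite_mem, Finset.univ_inter,
    Finset.prod_const]
  have hq0 : (0 : ℝ) ≤ q := q.2.1
  have hq1 : (q : ℝ) ≤ 1 := q.2.2
  calc (1 + q * (Real.exp s - 1)) ^ S.card
      ≤ Real.exp (q * (Real.exp s - 1)) ^ S.card := by
        refine pow_le_pow_left₀ (by nlinarith [Real.exp_pos s]) ?_ _
        linarith [Real.add_one_le_exp ((q : ℝ) * (Real.exp s - 1))]
    _ = Real.exp (q * S.card * (Real.exp s - 1)) := by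
        rw [← Real.exp_nat_mul]; ring_nf

/-- The sign of `s` is left free, so that one inequality serves both tails. -/
theorem count_chernoff {m : ℕ} (q : unitInterval) (S : Finset (Fin m)) (s a : ℝ) :
    (Measure.pi fun _ : Fin m => bernoulliMeasure true false q)
        {w | s * a ≤ s * (S.filter fun r => w r).card} ≤
      ENNReal.ofReal (Real.exp (-(s * a) + q * S.card * (Real.exp s - 1))) := by
  refine (measure_le_exp_mul_integral _ _ Integrable.of_finite).trans
    (ENNReal.ofReal_le_ofReal ?_)
  rw [Real.exp_add]
  exact mul_le_mul_of_nonneg_left (integral_exp_count_le q S s) (Real.exp_pos _).le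

/-- The Poisson rate function dominates the squared difference of square roots. -/
theorem rate_le_neg_sq_sqrt_sub {b c : ℝ} (hb : 0 < b) (hc : 0 < c) :
    -(2 * Real.log (b / c) * b ^ 2) + c ^ 2 * (Real.exp (2 * Real.log (b / c)) - 1) ≤
      -(b - c) ^ 2 := by
  have hbc : 0 < b / c := div_pos hb hc
  have h1 : Real.exp (2 * Real.log (b / c)) = (b / c) ^ 2 := by
    rw [two_mul, Real.exp_add, Real.exp_log hbc, pow_two]
  have h2 : c ^ 2 * ((b / c) ^ 2 - 1) = b ^ 2 - c ^ 2 := by field_simp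
  have h3 : -Real.log (b / c) ≤ c / b - 1 := by
    rw [← Real.log_inv, inv_div]
    exact Real.log_le_sub_one_of_pos (div_pos hc hb)
  have h4 : b ^ 2 * (c / b - 1) = b * c - b ^ 2 := by field_simp
  rw [h1, h2]
  nlinarith [mul_le_mul_of_nonneg_left h3 (sq_nonneg b)]

theorem sqrt_count_tail_row {m : ℕ} (q : unitInterval) (hq : 0 < q) (S : Finset (Fin m)) {x : ℝ}
    (hx : 0 ≤ x) :
    (Measure.pi fun _ : Fin m => bernoulliMeasure true false q)
        {w | x < |Real.sqrt ((S.filter fun r => w r).card : ℝ) - Real.sqrt (q * S.card)|} ≤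
      ENNReal.ofReal (2 * Real.exp (-x ^ 2)) := by
  rcases S.eq_empty_or_nonempty with rfl | hS
  · simp [not_lt.mpr hx]
  have hμ : 0 < (q : ℝ) * S.card := mul_pos hq (by exact_mod_cast hS.card_pos)
  set c := Real.sqrt (q * S.card) with hc
  have hc0 : 0 < c := Real.sqrt_pos.mpr hμ
  have hcsq : c ^ 2 = q * S.card := Real.sq_sqrt hμ.le
  -- The tilt `2 * log (b / c) = log (b ^ 2 / c ^ 2)` is the Poisson optimum at level `b ^ 2` for
  -- mean `c ^ 2`. It is used with `b = c + x` and `b = c - x`, where it is nonnegative and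
  -- nonpositive respectively.
  have key : ∀ b : ℝ, 0 < b → (b - c) ^ 2 = x ^ 2 →
      (Measure.pi fun _ : Fin m => bernoulliMeasure true false q)
        {w | 2 * Real.log (b / c) * b ^ 2 ≤ 2 * Real.log (b / c) * (S.filter fun r => w r).card} ≤
      ENNReal.ofReal (Real.exp (-x ^ 2)) := by
    intro b hb hbx
    refine (count_chernoff q S (2 * Real.log (b / c)) (b ^ 2)).trans
      (ENNReal.ofReal_le_ofReal (Real.exp_le_exp.mpr ?_))
    rw [← hcsq, ← hbx]
    exact rate_le_neg_sq_sqrt_sub hb hc0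
  have hup := key (c + x) (by linarith) (by ring)
  have hlow : (Measure.pi fun _ : Fin m => bernoulliMeasure true false q)
      {w | x < c - Real.sqrt ((S.filter fun r => w r).card : ℝ)} ≤
      ENNReal.ofReal (Real.exp (-x ^ 2)) := by
    -- For `x ≥ c` the lower tail is empty, since a square root cannot be negative.
    by_cases hxc : x < c
    · refine le_trans (measure_mono ?_) (key (c - x) (by linarith) (by ring))
      intro w hw
      have hw' : Real.sqrt ((S.filter fun r => w r).card : ℝ) ≤ c - x := by
        have : x < c - Real.sqrt ((S.filter fun r => w r).card : ℝ) := hw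
        linarith
      rw [Real.sqrt_le_left (by linarith)] at hw'
      have hlog : Real.log ((c - x) / c) ≤ 0 :=
        Real.log_nonpos (div_nonneg (by linarith) hc0.le) ((div_le_one hc0).mpr (by linarith))
      exact mul_le_mul_of_nonpos_left hw' (by linarith)
    · have : {w : Fin m → Bool | x < c - Real.sqrt ((S.filter fun r => w r).card : ℝ)} = ∅ := by
        refine Set.eq_empty_of_forall_notMem fun w hw => ?_
        have h1 : x < c - Real.sqrt ((S.filter fun r => w r).card : ℝ) := hw
        linarith [Real.sqrt_nonneg ((S.filter fun r => w r).card : ℝ)]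
      rw [this]; simp
  rw [two_mul, ENNReal.ofReal_add (Real.exp_pos _).le (Real.exp_pos _).le]
  refine le_trans (measure_mono ?_) ((measure_union_le _ _).trans (add_le_add hup hlow))
  intro w hw
  have hw' : x < |Real.sqrt ((S.filter fun r => w r).card : ℝ) - c| := hw
  rcases lt_abs.mp hw' with h | h
  · left
    have h' : c + x ≤ Real.sqrt ((S.filter fun r => w r).card : ℝ) := by linarith
    rw [Real.le_sqrt (by linarith) (Nat.cast_nonneg _)] at h'
    have hlog : 0 ≤ Real.log ((c + x) / c) := Real.log_nonneg ((one_le_div hc0).mpr (by linarith))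
    exact mul_le_mul_of_nonneg_left h' (by linarith)
  · right
    have : x < c - Real.sqrt ((S.filter fun r => w r).card : ℝ) := by linarith
    exact this

theorem sqrt_count_tail {p m : ℕ} (q : Fin p → unitInterval) (j : Fin p) (hq : 0 < q j)
    (S : Finset (Fin m)) {x : ℝ} (hx : 0 ≤ x) :
    (Measure.pi fun j => Measure.pi fun _ : Fin m => bernoulliMeasure true false (q j))
        {w | x < |Real.sqrt ((S.filter fun r => w j r).card : ℝ) -
          Real.sqrt (q j * S.card)|} ≤
      ENNReal.ofReal (2 * Real.exp (-x ^ 2)) := by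
  have h := measurePreserving_eval
    (fun j => Measure.pi fun _ : Fin m => bernoulliMeasure true false (q j)) j
  refine le_trans (le_of_eq ?_) (sqrt_count_tail_row (q j) hq S hx)
  exact h.measure_preimage (s := {w : Fin m → Bool |
      x < |Real.sqrt ((S.filter fun r => w r).card : ℝ) - Real.sqrt (q j * S.card)|})
    (Set.toFinite _).measurableSet.nullMeasurableSet

/-! ### The shape of the CUSUM curve of a single change -/

/-- The CUSUM curve of a unit change, as a function of the square roots of the counts. -/
noncomputable def cusumShape (l ρ r ν : ℝ) : ℝ := l / ν * (ρ * (ρ / r))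

theorem cusumShape_smul {c : ℝ} (hc : 0 < c) (l ρ r ν : ℝ) :
    cusumShape (c * l) (c * ρ) (c * r) (c * ν) = c * cusumShape l ρ r ν := by
  unfold cusumShape
  rw [mul_div_mul_left _ _ hc.ne', mul_div_mul_left _ _ hc.ne']
  ring

/-- The difference can be written with the ratios `ρ / r` and `ρ' / r'` as its only coefficients.
They lie in `[0, 1]`, so three increments of size `x` suffice; vanishing denominators are treated
apart. -/
theorem abs_mul_div_sub_le {ρ r ρ' r' x : ℝ} (hρ : 0 ≤ ρ) (hρr : ρ ≤ r)
    (hρ' : 0 ≤ ρ') (hρr' : ρ' ≤ r') (h1 : |ρ - ρ'| ≤ x) (h2 : |r - r'| ≤ x) :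
    |ρ * (ρ / r) - ρ' * (ρ' / r')| ≤ 3 * x := by
  have hx : 0 ≤ x := (abs_nonneg _).trans h1
  have hdiv : ∀ {a b : ℝ}, 0 ≤ a → a ≤ b → 0 ≤ a / b ∧ a / b ≤ 1 := fun ha hab =>
    ⟨div_nonneg ha (ha.trans hab), div_le_one_of_le₀ hab (ha.trans hab)⟩
  obtain ⟨u0, u1⟩ := hdiv hρ hρr
  obtain ⟨u0', u1'⟩ := hdiv hρ' hρr'
  rcases (hρ.trans hρr).eq_or_lt with hr | hr
  · have : ρ = 0 := le_antisymm (hr ▸ hρr) hρ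
    subst this
    rw [abs_le] at h1
    rw [zero_mul, zero_sub, abs_neg, abs_of_nonneg (mul_nonneg hρ' u0')]
    nlinarith
  rcases (hρ'.trans hρr').eq_or_lt with hr' | hr'
  · have : ρ' = 0 := le_antisymm (hr' ▸ hρr') hρ'
    subst this
    rw [abs_le] at h1
    rw [zero_mul, sub_zero, abs_of_nonneg (mul_nonneg hρ u0)]
    nlinarith
  have hid : ρ * (ρ / r) - ρ' * (ρ' / r') =
      (ρ / r) * (ρ - ρ') + (ρ' / r') * ((ρ / r) * (r' - r) + (ρ - ρ')) := by
    field_simp; ring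
  rw [abs_le] at h1 h2 ⊢
  rw [hid]
  have hprod : ∀ {a b : ℝ}, 0 ≤ a → a ≤ 1 → -b ≤ 0 → ∀ y, -b ≤ y → y ≤ b →
      -b ≤ a * y ∧ a * y ≤ b := by
    intro a b ha0 ha1 _ y hy1 hy2
    constructor <;> nlinarith
  obtain ⟨a1, a2⟩ := hprod u0 u1 (neg_nonpos.mpr hx) _ h1.1 h1.2
  obtain ⟨b1, b2⟩ := hprod u0 u1 (neg_nonpos.mpr hx) (r' - r) (by linarith) (by linarith)
  obtain ⟨c1, c2⟩ := hprod (b := 2 * x) u0' u1' (by linarith)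
    ((ρ / r) * (r' - r) + (ρ - ρ')) (by linarith) (by linarith)
  constructor <;> linarith

/-- The CUSUM curve is Lipschitz in the square roots of the counts. -/
theorem abs_cusumShape_sub_le {l ρ r ν l' ρ' r' ν' x : ℝ}
    (hl : 0 ≤ l) (hρ : 0 ≤ ρ) (hρr : ρ ≤ r) (hrν : r ≤ ν) (hlν : l ≤ ν)
    (hl' : 0 ≤ l') (hρ' : 0 ≤ ρ') (hρr' : ρ' ≤ r') (hrν' : r' ≤ ν') (hlν' : l' ≤ ν')
    (h1 : |l - l'| ≤ x) (h2 : |ρ - ρ'| ≤ x) (h3 : |r - r'| ≤ x) (h4 : |ν - ν'| ≤ x) :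
    |cusumShape l ρ r ν - cusumShape l' ρ' r' ν'| ≤ 5 * x := by
  have hg := abs_mul_div_sub_le hρ hρr hρ' hρr' h2 h3
  have hdiv : ∀ {a b : ℝ}, 0 ≤ a → a ≤ b → 0 ≤ a / b ∧ a / b ≤ 1 := fun ha hab =>
    ⟨div_nonneg ha (ha.trans hab), div_le_one_of_le₀ hab (ha.trans hab)⟩
  have hgbound : ∀ {a b c : ℝ}, 0 ≤ a → a ≤ b → b ≤ c → 0 ≤ a * (a / b) ∧ a * (a / b) ≤ c := by
    intro a b c ha hab hbc
    obtain ⟨k0, k1⟩ := hdiv ha hab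
    exact ⟨mul_nonneg ha k0, by nlinarith⟩
  have hx : 0 ≤ x := (abs_nonneg _).trans h1
  obtain ⟨g0, g1⟩ := hgbound hρ hρr hrν
  obtain ⟨g0', g1'⟩ := hgbound hρ' hρr' hrν'
  obtain ⟨w0, w1⟩ := hdiv hl hlν
  obtain ⟨w0', w1'⟩ := hdiv hl' hlν'
  unfold cusumShape
  generalize ρ * (ρ / r) = g at *
  generalize ρ' * (ρ' / r') = g' at *
  rw [abs_le] at h1 h4 hg
  rcases (hl.trans hlν).eq_or_lt with hν | hν
  · have : l = 0 := le_antisymm (hν ▸ hlν) hl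
    subst this
    have hg0 : g = 0 := le_antisymm (hν ▸ g1) g0
    rw [zero_div, zero_mul, zero_sub, abs_neg, abs_of_nonneg (mul_nonneg w0' g0')]
    nlinarith
  rcases (hl'.trans hlν').eq_or_lt with hν' | hν'
  · have : l' = 0 := le_antisymm (hν' ▸ hlν') hl'
    subst this
    have hg0 : g' = 0 := le_antisymm (hν' ▸ g1') g0'
    rw [zero_div, zero_mul, sub_zero, abs_of_nonneg (mul_nonneg w0 g0)]
    nlinarith
  -- All the ratios here are in `[0, 1]`: the change in `g` costs `3 * x`, those in `ν` and `l` cost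
  -- `x` each.
  have hid : l / ν * g - l' / ν' * g' =
      (l / ν) * (g - g') + (g' / ν') * ((l / ν) * (ν' - ν) + (l - l')) := by
    field_simp; ring
  obtain ⟨e0, e1⟩ := hdiv g0' g1'
  rw [hid, abs_le]
  have hprod : ∀ {a b : ℝ}, 0 ≤ a → a ≤ 1 → -b ≤ 0 → ∀ y, -b ≤ y → y ≤ b →
      -b ≤ a * y ∧ a * y ≤ b := by
    intro a b ha0 ha1 _ y hy1 hy2
    constructor <;> nlinarith
  obtain ⟨a1, a2⟩ := hprod (b := 3 * x) w0 w1 (by linarith) (g - g') (by linarith) (by linarith)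
  obtain ⟨b1, b2⟩ := hprod w0 w1 (neg_nonpos.mpr hx) (ν' - ν) (by linarith) (by linarith)
  obtain ⟨c1, c2⟩ := hprod (b := 2 * x) e0 e1 (by linarith)
    ((l / ν) * (ν' - ν) + (l - l')) (by linarith) (by linarith)
  constructor <;> linarith

/-- The CUSUM curve of a unit change after time `z` among `m` fully observed time points. -/
noncomputable def cusumCurve (m z t : ℕ) : ℝ :=
  if t ≤ z then
    cusumShape (Real.sqrt t) (Real.sqrt (m - z : ℕ)) (Real.sqrt (m - t : ℕ)) (Real.sqrt m)
  else
    cusumShape (Real.sqrt (m - t : ℕ)) (Real.sqrt z) (Real.sqrt t) (Real.sqrt m)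

/-- Time reversal. -/
theorem cusumCurve_reflect {m z t : ℕ} (hz : z ≤ m) (ht : t ≤ m) (hz0 : 0 < z) (htm : 0 < t) :
    cusumCurve m (m - z) (m - t) = cusumCurve m z t := by
  unfold cusumCurve
  have e1 : m - (m - z) = z := by omega
  have e2 : m - (m - t) = t := by omega
  rw [e1, e2]
  rcases lt_trichotomy t z with h | h | h
  · rw [if_neg (by omega), if_pos (by omega)]
  · subst h
    simp only [le_refl, if_true]
    unfold cusumShape
    have a1 : Real.sqrt t ≠ 0 := (Real.sqrt_pos.mpr (by exact_mod_cast htm)).ne'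
    rcases (Nat.zero_le (m - t)).eq_or_lt with h0 | h0
    · rw [← h0]; simp
    have a2 : Real.sqrt (m - t : ℕ) ≠ 0 := (Real.sqrt_pos.mpr (by exact_mod_cast h0)).ne'
    rw [div_self a1, div_self a2]; ring
  · rw [if_pos (by omega), if_neg (by omega)]

theorem cusumCurve_nonneg (m z t : ℕ) : 0 ≤ cusumCurve m z t := by
  unfold cusumCurve cusumShape
  split_ifs <;> positivity

theorem cusumCurve_sq_of_le {m z t : ℕ} (ht : t ≤ z) :
    cusumCurve m z t ^ 2 = t / m * ((m - z : ℕ) ^ 2 / (m - t : ℕ)) := by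
  unfold cusumCurve cusumShape
  rw [if_pos ht, mul_pow, mul_pow, div_pow, div_pow]
  simp only [Real.sq_sqrt (Nat.cast_nonneg _)]
  ring

theorem sum_range_succ_cast (z : ℕ) : ∑ i ∈ Finset.range z, ((i : ℝ) + 1) = z * (z + 1) / 2 := by
  induction z with
  | zero => simp
  | succ k ih => rw [Finset.sum_range_succ, ih]; push_cast; ring

/-- The part of the sum up to `z` is enough: there the squared curve is at least `(m - z) ^ 2 * t /
m ^ 2`, and `z ≥ m / 2` makes the sum of the `t` at least `m ^ 2 / 8`. -/
theorem sum_cusumCurve_sq_of_le {m z : ℕ} (hzm : z < m) (h2 : m ≤ 2 * z) :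
    ((m - z : ℕ) : ℝ) ^ 2 / 8 ≤ ∑ i ∈ Finset.range (m - 1), cusumCurve m z (i + 1) ^ 2 := by
  have hm : (0 : ℝ) < m := by exact_mod_cast (by omega : 0 < m)
  calc ((m - z : ℕ) : ℝ) ^ 2 / 8
      ≤ ((m - z : ℕ) : ℝ) ^ 2 / m ^ 2 * ∑ i ∈ Finset.range z, ((i : ℝ) + 1) := by
        rw [sum_range_succ_cast, div_mul_eq_mul_div, le_div_iff₀ (by positivity)]
        have : (m : ℝ) ≤ 2 * z := by exact_mod_cast h2
        have h3 : (m : ℝ) ^ 2 / 8 ≤ (z : ℝ) * (z + 1) / 2 := by nlinarith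
        calc ((m - z : ℕ) : ℝ) ^ 2 / 8 * m ^ 2 = ((m - z : ℕ) : ℝ) ^ 2 * (m ^ 2 / 8) := by ring
          _ ≤ _ := mul_le_mul_of_nonneg_left h3 (sq_nonneg _)
    _ ≤ ∑ i ∈ Finset.range z, cusumCurve m z (i + 1) ^ 2 := by
        rw [Finset.mul_sum]
        refine Finset.sum_le_sum fun i hi => ?_
        have hiz : i + 1 ≤ z := Finset.mem_range.mp hi
        rw [cusumCurve_sq_of_le hiz]
        have hpos : (0 : ℝ) < (m - (i + 1) : ℕ) := by exact_mod_cast (by omega)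
        have hle : ((m - (i + 1) : ℕ) : ℝ) ≤ m := by exact_mod_cast (by omega)
        have h3 : ((m - z : ℕ) : ℝ) ^ 2 / m ≤ ((m - z : ℕ) : ℝ) ^ 2 / (m - (i + 1) : ℕ) :=
          div_le_div_of_nonneg_left (sq_nonneg _) hpos hle
        calc ((m - z : ℕ) : ℝ) ^ 2 / m ^ 2 * ((i : ℝ) + 1)
            = ((i + 1 : ℕ) : ℝ) / m * (((m - z : ℕ) : ℝ) ^ 2 / m) := by
              push_cast; field_simp
          _ ≤ _ := mul_le_mul_of_nonneg_left h3 (by positivity)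
    _ ≤ _ := Finset.sum_le_sum_of_subset_of_nonneg
        (Finset.range_mono (by omega)) fun _ _ _ => sq_nonneg _

theorem sum_cusumCurve_sq {m z : ℕ} (hz : 0 < z) (hzm : z < m) :
    ((min z (m - z) : ℕ) : ℝ) ^ 2 / 8 ≤
      ∑ i ∈ Finset.range (m - 1), cusumCurve m z (i + 1) ^ 2 := by
  rcases le_total m (2 * z) with h | h
  · rw [min_eq_right (by omega)]
    exact sum_cusumCurve_sq_of_le hzm h
  · rw [min_eq_left (by omega), ← Finset.sum_range_reflect]
    have := sum_cusumCurve_sq_of_le (m := m) (z := m - z) (by omega) (by omega)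
    rw [show m - (m - z) = z by omega] at this
    refine this.trans (le_of_eq (Finset.sum_congr rfl fun i hi => ?_))
    have hi' := Finset.mem_range.mp hi
    rw [← cusumCurve_reflect hzm.le (t := m - 1 - 1 - i + 1) (by omega) hz (by omega)]
    congr 3
    omega

/-- The drop is `b * (a * d - b * c) / (M * d)`. The difference of squares `(a * d) ^ 2 - (b * c) ^
2` equals `M ^ 2 * D`, so dividing by `a * d + b * c ≤ 2 * a * d` bounds the middle factor below
linearly in the distance `D`. -/
theorem cusumShape_drop {a b c d M D : ℝ} (ha : 0 < a) (hb : 0 < b) (hd : 0 < d)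
    (hM : 0 < M) (hM2 : M ^ 2 = a ^ 2 + b ^ 2) (hD : 0 ≤ D) (hc2 : c ^ 2 = a ^ 2 - D)
    (hd2 : d ^ 2 = b ^ 2 + D) :
    b * M * D / (2 * a * d ^ 2) ≤ cusumShape a b b M - cusumShape c b d M := by
  unfold cusumShape
  have hle : b * c ≤ a * d := by
    refine le_of_sq_le_sq ?_ (by positivity)
    rw [mul_pow, mul_pow, hc2, hd2]
    nlinarith [mul_nonneg (sq_nonneg a) hD, mul_nonneg (sq_nonneg b) hD]
  have hdiff : (a * d - b * c) * (a * d + b * c) = M ^ 2 * D := by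
    have : (a * d - b * c) * (a * d + b * c) = a ^ 2 * d ^ 2 - b ^ 2 * c ^ 2 := by ring
    rw [this, hc2, hd2, hM2]; ring
  have h1 : M ^ 2 * D ≤ (a * d - b * c) * (2 * (a * d)) := by
    rw [← hdiff]
    exact mul_le_mul_of_nonneg_left (by linarith) (by linarith)
  have h2 : a / M * (b * (b / b)) - c / M * (b * (b / d)) = b * (a * d - b * c) / (M * d) := by
    field_simp
  rw [h2, div_le_div_iff₀ (by positivity) (by positivity)]
  calc b * M * D * (M * d) = b * d * (M ^ 2 * D) := by ring
    _ ≤ b * d * ((a * d - b * c) * (2 * (a * d))) := mul_le_mul_of_nonneg_left h1 (by positivity)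
    _ = _ := by ring

/-- The drop of the CUSUM curve to the left of its peak. -/
theorem cusumCurve_drop_left {m z t : ℕ} (hzm : z < m) (ht : t ≤ z) (ht0 : 0 < t) {δ : ℝ}
    (hδ : cusumCurve m z z - cusumCurve m z t ≤ δ)
    (hsmall : δ < Real.sqrt (min z (m - z) : ℕ) / 4) :
    ((z - t : ℕ) : ℝ) ≤ 4 * Real.sqrt (min z (m - z) : ℕ) * δ := by
  have hsq : ∀ k : ℕ, Real.sqrt (k : ℝ) ^ 2 = k := fun k => Real.sq_sqrt (Nat.cast_nonneg _)
  have hpos : ∀ {k : ℕ}, 0 < k → 0 < Real.sqrt (k : ℝ) := fun h =>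
    Real.sqrt_pos.mpr (by exact_mod_cast h)
  have e1 : (m : ℝ) = z + (m - z : ℕ) := by rw [Nat.cast_sub hzm.le]; ring
  have e2 : (t : ℝ) = z - (z - t : ℕ) := by rw [Nat.cast_sub ht]; ring
  have e3 : ((m - t : ℕ) : ℝ) = (m - z : ℕ) + (z - t : ℕ) := by
    rw [Nat.cast_sub ht, Nat.cast_sub hzm.le, Nat.cast_sub (ht.trans hzm.le)]; ring
  have ha0 := hpos (show 0 < z by omega)
  have hb0 := hpos (show 0 < m - z by omega)
  have hM0 := hpos (show 0 < m by omega)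
  have hd0 := hpos (show 0 < m - t by omega)
  have hdrop := cusumShape_drop (c := Real.sqrt t) (D := (z - t : ℕ)) ha0 hb0 hd0 hM0
    (by rw [hsq, hsq, hsq]; exact e1) (Nat.cast_nonneg _) (by rw [hsq, hsq]; exact e2)
    (by rw [hsq, hsq]; exact e3)
  have hδ' := hδ
  unfold cusumCurve at hδ'
  rw [if_pos le_rfl, if_pos ht] at hδ'
  replace hdrop := hdrop.trans hδ'
  have ha2 := hsq z
  have hM2 : Real.sqrt m ^ 2 = Real.sqrt z ^ 2 + Real.sqrt (m - z : ℕ) ^ 2 := by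
    rw [hsq, hsq, hsq]; exact e1
  have hd2 : Real.sqrt (m - t : ℕ) ^ 2 = Real.sqrt (m - z : ℕ) ^ 2 + (z - t : ℕ) := by
    rw [hsq, hsq]; exact e3
  rw [hd2] at hdrop
  have hD : (0 : ℝ) ≤ (z - t : ℕ) := Nat.cast_nonneg _
  have hDz : ((z - t : ℕ) : ℝ) ≤ Real.sqrt z ^ 2 := by rw [ha2]; exact_mod_cast (by omega)
  have hcmp : z ≤ m - z → Real.sqrt z ≤ Real.sqrt (m - z : ℕ) := fun h =>
    Real.sqrt_le_sqrt (by exact_mod_cast h)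
  clear hδ hδ'
  generalize ((z - t : ℕ) : ℝ) = D at *
  rw [div_le_iff₀ (by positivity)] at hdrop
  rcases le_total z (m - z) with h | h
  -- When `z` is the shorter side, `D ≤ z` already gives `b ^ 2 + D ≤ M ^ 2`, and the linear bound
  -- holds without the smallness of `δ`.
  · rw [min_eq_left h] at hsmall ⊢
    have hab := hcmp h
    generalize Real.sqrt z = a at *
    generalize Real.sqrt (m - z : ℕ) = b at *
    generalize Real.sqrt m = M at *
    have hMb : M ≤ 2 * b := by nlinarith
    have hδ0 : 0 ≤ δ := by
      by_contra hneg
      have : δ * (2 * a * (b ^ 2 + D)) < 0 := mul_neg_of_neg_of_pos (not_le.mp hneg) (by positivity)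
      linarith [show 0 ≤ b * M * D by positivity]
    have h1 : b * M * D ≤ δ * (2 * a * M ^ 2) :=
      hdrop.trans (mul_le_mul_of_nonneg_left
        (mul_le_mul_of_nonneg_left (by linarith : b ^ 2 + D ≤ M ^ 2) (by positivity)) hδ0)
    have h2 : b * D ≤ 2 * a * δ * M := by
      refine le_of_mul_le_mul_right ?_ hM0
      linarith
    have h3 : 2 * a * δ * M ≤ 2 * a * δ * (2 * b) :=
      mul_le_mul_of_nonneg_left hMb (by positivity)
    refine le_of_mul_le_mul_left ?_ hb0
    linarith
  · rw [min_eq_right h] at hsmall ⊢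
    generalize Real.sqrt z = a at *
    generalize Real.sqrt (m - z : ℕ) = b at *
    generalize Real.sqrt m = M at *
    have haM : a ≤ M := by nlinarith
    have h1 : b * D ≤ δ * (2 * (b ^ 2 + D)) := by
      refine le_of_mul_le_mul_left ?_ ha0
      calc a * (b * D) ≤ M * (b * D) := mul_le_mul_of_nonneg_right haM (by positivity)
        _ = b * M * D := by ring
        _ ≤ _ := hdrop
        _ = _ := by ring
    -- The lower bound on the drop saturates once `D` exceeds `b ^ 2`. A drop below `b / 4` excludes
    -- that range.
    have hDb : D ≤ b ^ 2 := by
      by_contra hlt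
      rw [not_le] at hlt
      have : δ * (2 * (b ^ 2 + D)) < b / 4 * (2 * (b ^ 2 + D)) :=
        mul_lt_mul_of_pos_right hsmall (by positivity)
      nlinarith
    have hδ0 : 0 ≤ δ := by
      by_contra hneg
      have : δ * (2 * (b ^ 2 + D)) < 0 := mul_neg_of_neg_of_pos (not_le.mp hneg) (by positivity)
      linarith [show 0 ≤ b * D by positivity]
    refine le_of_mul_le_mul_left ?_ hb0
    have : δ * (2 * (b ^ 2 + D)) ≤ δ * (2 * (b ^ 2 + b ^ 2)) :=
      mul_le_mul_of_nonneg_left (by linarith) hδ0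
    linarith

theorem cusumCurve_drop {m z t : ℕ} (hz : 0 < z) (hzm : z < m) (ht0 : 0 < t) (htm : t < m) {δ : ℝ}
    (hδ : cusumCurve m z z - cusumCurve m z t ≤ δ)
    (hsmall : δ < Real.sqrt (min z (m - z) : ℕ) / 4) :
    |(t : ℝ) - z| ≤ 4 * Real.sqrt (min z (m - z) : ℕ) * δ := by
  rcases le_total t z with h | h
  · have := cusumCurve_drop_left hzm h ht0 hδ hsmall
    rw [abs_sub_comm, abs_of_nonneg (sub_nonneg.mpr (by exact_mod_cast h))]
    rwa [Nat.cast_sub h] at this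
  · have hmin : min (m - z) (m - (m - z)) = min z (m - z) := by omega
    have := cusumCurve_drop_left (m := m) (z := m - z) (t := m - t) (δ := δ) (by omega) (by omega)
      (by omega) (by
        rwa [cusumCurve_reflect hzm.le hzm.le hz hz, cusumCurve_reflect hzm.le htm.le hz ht0])
      (by rwa [hmin])
    rw [hmin, show m - z - (m - t) = t - z by omega, Nat.cast_sub h] at this
    rwa [abs_of_nonneg (sub_nonneg.mpr (by exact_mod_cast h))]

/-! ### The MissCUSUM transformation as a linear map -/

/-- The weight of the observation at time `r + 1` in the MissCUSUM statistic at time `t`. -/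
noncomputable def cusumCoef {p m : ℕ} (W : Fin p → Fin m → Bool) (j : Fin p) (t : ℕ) (r : Fin m) :
    ℝ :=
  if (0 < leftCount W j t ∧ 0 < rightCount W j (m - t)) ∧ W j r then
    Real.sqrt ((leftCount W j t : ℝ) * rightCount W j (m - t) / leftCount W j m) *
      if r.val + 1 ≤ t then -(1 / (leftCount W j t : ℝ)) else 1 / (rightCount W j (m - t) : ℝ)
  else 0

section

variable {p m : ℕ} (W : Fin p → Fin m → Bool) (j : Fin p)

theorem sum_ite_leftCount (t : ℕ) (c : ℝ) :
    ∑ r : Fin m, (if r.val + 1 ≤ t ∧ W j r then c else 0) = leftCount W j t * c := by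
  rw [← Finset.sum_filter, Finset.sum_const, nsmul_eq_mul, leftCount]

theorem sum_ite_rightCount {t : ℕ} (ht : t ≤ m) (c : ℝ) :
    ∑ r : Fin m, (if ¬ r.val + 1 ≤ t ∧ W j r then c else 0) = rightCount W j (m - t) * c := by
  rw [← Finset.sum_filter, Finset.sum_const, nsmul_eq_mul, rightCount]
  congr 3
  ext r
  simp only [Finset.mem_filter, Finset.mem_univ, true_and]
  refine and_congr_left fun _ => ?_
  omega

theorem leftCount_add_rightCount {t : ℕ} (ht : t ≤ m) :
    leftCount W j t + rightCount W j (m - t) = leftCount W j m := by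
  have h1 := sum_ite_leftCount W j t 1
  have h2 := sum_ite_rightCount W j ht 1
  have h3 := sum_ite_leftCount W j m 1
  rw [mul_one] at h1 h2 h3
  have : (leftCount W j t : ℝ) + rightCount W j (m - t) = leftCount W j m := by
    rw [← h1, ← h2, ← h3, ← Finset.sum_add_distrib]
    refine Finset.sum_congr rfl fun r _ => ?_
    have := r.isLt
    by_cases h : r.val + 1 ≤ t <;> by_cases hw : W j r <;> simp [h, hw]
  exact_mod_cast this

/-- Masking is idempotent, so applying the transformation to data already masked changes nothing. -/
theorem missCusumAt_mask_mask (M : Fin p → Fin m → ℝ) (t : ℕ) :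
    missCusumAt (mask M W) W j t = ∑ r, cusumCoef W j t r * M j r := by
  unfold missCusumAt cusumCoef
  by_cases h : 0 < leftCount W j t ∧ 0 < rightCount W j (m - t)
  · simp only [h, and_self, if_true, true_and]
    rw [Finset.mul_sum, Finset.mul_sum, Finset.sum_filter, Finset.sum_filter,
      ← Finset.sum_sub_distrib, Finset.mul_sum]
    refine Finset.sum_congr rfl fun r _ => ?_
    unfold mask
    by_cases hr : r.val + 1 ≤ t
    · have : ¬ t + 1 ≤ r.val + 1 := by omega
      cases hw : W j r <;> simp [hr, this]; ring
    · have : t + 1 ≤ r.val + 1 := by omega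
      cases hw : W j r <;> simp [hr, this]; ring
  · simp [h]

theorem cusumCoef_of_not {t : ℕ} (h : ¬ (0 < leftCount W j t ∧ 0 < rightCount W j (m - t)))
    (r : Fin m) : cusumCoef W j t r = 0 := by
  simp [cusumCoef, h]

theorem cusumCoef_of_pos {t : ℕ} (h : 0 < leftCount W j t ∧ 0 < rightCount W j (m - t))
    (r : Fin m) : cusumCoef W j t r =
      (if r.val + 1 ≤ t ∧ W j r then
        -(Real.sqrt ((leftCount W j t : ℝ) * rightCount W j (m - t) / leftCount W j m) /
          leftCount W j t) else 0) +
      if ¬ r.val + 1 ≤ t ∧ W j r then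
        Real.sqrt ((leftCount W j t : ℝ) * rightCount W j (m - t) / leftCount W j m) /
          rightCount W j (m - t) else 0 := by
  unfold cusumCoef
  by_cases hr : r.val + 1 ≤ t <;> cases hw : W j r <;> simp [h, hr] <;> ring

/-- With both counts positive the sum is `(L * R / N) * (1 / L + 1 / R) = 1`; otherwise it is zero.
The noise thus has variance at most `σ ^ 2`, whatever is observed. -/
theorem sum_cusumCoef_sq_le {t : ℕ} (ht : t ≤ m) : ∑ r, cusumCoef W j t r ^ 2 ≤ 1 := by
  by_cases h : 0 < leftCount W j t ∧ 0 < rightCount W j (m - t)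
  swap
  · simp [cusumCoef_of_not W j h]
  have hN : (leftCount W j t : ℝ) + rightCount W j (m - t) = leftCount W j m := by
    exact_mod_cast leftCount_add_rightCount W j ht
  have hL : (0 : ℝ) < leftCount W j t := by exact_mod_cast h.1
  have hR : (0 : ℝ) < rightCount W j (m - t) := by exact_mod_cast h.2
  set κ := Real.sqrt ((leftCount W j t : ℝ) * rightCount W j (m - t) / leftCount W j m) with hκ
  have hκ2 : κ ^ 2 = (leftCount W j t : ℝ) * rightCount W j (m - t) / leftCount W j m :=
    Real.sq_sqrt (by positivity)
  have hsq : ∀ r, cusumCoef W j t r ^ 2 =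
      (if r.val + 1 ≤ t ∧ W j r then (κ / leftCount W j t) ^ 2 else 0) +
      if ¬ r.val + 1 ≤ t ∧ W j r then (κ / rightCount W j (m - t)) ^ 2 else 0 := by
    intro r
    rw [cusumCoef_of_pos W j h]
    by_cases hr : r.val + 1 ≤ t <;> cases hw : W j r <;> simp [hr, hκ]
  rw [Finset.sum_congr rfl fun r _ => hsq r, Finset.sum_add_distrib, sum_ite_leftCount,
    sum_ite_rightCount W j ht, div_pow, div_pow, hκ2, ← hN]
  refine le_of_eq ?_
  field_simp
  ring

/-- The transformation annihilates constant rows, so only the jump survives in the mean. -/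
theorem sum_cusumCoef {t : ℕ} (ht : t ≤ m) : ∑ r, cusumCoef W j t r = 0 := by
  by_cases h : 0 < leftCount W j t ∧ 0 < rightCount W j (m - t)
  swap
  · simp [cusumCoef_of_not W j h]
  have hL : (0 : ℝ) < leftCount W j t := by exact_mod_cast h.1
  have hR : (0 : ℝ) < rightCount W j (m - t) := by exact_mod_cast h.2
  rw [Finset.sum_congr rfl fun r _ => cusumCoef_of_pos W j h r, Finset.sum_add_distrib,
    sum_ite_leftCount, sum_ite_rightCount W j ht]
  field_simp
  ring

theorem leftCount_mono {s t : ℕ} (h : s ≤ t) : leftCount W j s ≤ leftCount W j t :=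
  Finset.card_le_card fun r hr => by
    simp only [Finset.mem_filter, Finset.mem_univ, true_and] at hr ⊢
    exact ⟨by omega, hr.2⟩

theorem rightCount_mono {s t : ℕ} (h : s ≤ t) : rightCount W j s ≤ rightCount W j t :=
  Finset.card_le_card fun r hr => by
    simp only [Finset.mem_filter, Finset.mem_univ, true_and] at hr ⊢
    exact ⟨by omega, hr.2⟩

theorem sqrt_mul_div_div {L R N Z : ℝ} (hL : 0 ≤ L) (hR : 0 < R) (hZ : 0 ≤ Z) :
    Z * (Real.sqrt (L * R / N) / R) =
      cusumShape (Real.sqrt L) (Real.sqrt Z) (Real.sqrt R) (Real.sqrt N) := by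
  unfold cusumShape
  rw [Real.sqrt_div (by positivity), Real.sqrt_mul hL]
  have h1 := Real.sq_sqrt hZ
  have h2 := Real.sq_sqrt hR.le
  have h3 : 0 < Real.sqrt R := Real.sqrt_pos.mpr hR
  generalize Real.sqrt R = r at *
  generalize Real.sqrt Z = ζ at *
  subst h1 h2
  field_simp

/-- The MissCUSUM transformation of the mean matrix, in terms of square roots of counts. -/
theorem sum_cusumCoef_mul_meanMatrix {z t : ℕ} (μ₁ μ₂ : EuclideanSpace ℝ (Fin p)) (ht : t ≤ m)
    (hz : z ≤ m) :
    ∑ r, cusumCoef W j t r * meanMatrix m z μ₁ μ₂ j r = (μ₂ j - μ₁ j) *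
      if t ≤ z then
        cusumShape (Real.sqrt (leftCount W j t)) (Real.sqrt (rightCount W j (m - z)))
          (Real.sqrt (rightCount W j (m - t))) (Real.sqrt (leftCount W j m))
      else
        cusumShape (Real.sqrt (rightCount W j (m - t))) (Real.sqrt (leftCount W j z))
          (Real.sqrt (leftCount W j t)) (Real.sqrt (leftCount W j m)) := by
  by_cases h : 0 < leftCount W j t ∧ 0 < rightCount W j (m - t)
  swap
  · have : (0 : ℝ) = if t ≤ z then
        cusumShape (Real.sqrt (leftCount W j t)) (Real.sqrt (rightCount W j (m - z)))
          (Real.sqrt (rightCount W j (m - t))) (Real.sqrt (leftCount W j m))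
      else
        cusumShape (Real.sqrt (rightCount W j (m - t))) (Real.sqrt (leftCount W j z))
          (Real.sqrt (leftCount W j t)) (Real.sqrt (leftCount W j m)) := by
      -- Either vanishing count kills the shape, as a zero factor or through division by zero.
      have h0 : leftCount W j t = 0 ∨ rightCount W j (m - t) = 0 := by omega
      rcases h0 with h0 | h0 <;> simp [cusumShape, h0]
    rw [← this]
    simp [cusumCoef_of_not W j h]
  have hL : (0 : ℝ) < leftCount W j t := by exact_mod_cast h.1
  have hR : (0 : ℝ) < rightCount W j (m - t) := by exact_mod_cast h.2
  set κ := Real.sqrt ((leftCount W j t : ℝ) * rightCount W j (m - t) / leftCount W j m) with hκ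
  split_ifs with htz
  -- Subtracting the constant `μ₁ j` leaves only times after `z`, which all lie to the right of the
  -- split and share one weight. For `t > z` the constant is `μ₂ j` instead.
  · have hsplit : ∀ r : Fin m, cusumCoef W j t r * meanMatrix m z μ₁ μ₂ j r =
        μ₁ j * cusumCoef W j t r + if ¬ r.val + 1 ≤ z ∧ W j r then
          (μ₂ j - μ₁ j) * (κ / rightCount W j (m - t)) else 0 := by
      intro r
      rw [cusumCoef_of_pos W j h, meanMatrix]
      by_cases h1 : r.val + 1 ≤ t
      · have h2 : r.val + 1 ≤ z := by omega
        simp [h1, h2, mul_comm]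
      · by_cases h2 : r.val + 1 ≤ z <;> cases hw : W j r <;> simp [h1, h2, ← hκ] <;> ring
    rw [Finset.sum_congr rfl fun r _ => hsplit r, Finset.sum_add_distrib, ← Finset.mul_sum,
      sum_cusumCoef W j ht, sum_ite_rightCount W j hz, mul_zero, zero_add,
      ← sqrt_mul_div_div hL.le hR (Nat.cast_nonneg _)]
    ring
  · have hsplit : ∀ r : Fin m, cusumCoef W j t r * meanMatrix m z μ₁ μ₂ j r =
        μ₂ j * cusumCoef W j t r + if r.val + 1 ≤ z ∧ W j r then
          (μ₂ j - μ₁ j) * (κ / leftCount W j t) else 0 := by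
      intro r
      rw [cusumCoef_of_pos W j h, meanMatrix]
      by_cases h2 : r.val + 1 ≤ z
      · have h1 : r.val + 1 ≤ t := by omega
        cases hw : W j r <;> simp [h1, h2, ← hκ]; ring
      · simp [h2, mul_comm]
    rw [Finset.sum_congr rfl fun r _ => hsplit r, Finset.sum_add_distrib, ← Finset.mul_sum,
      sum_cusumCoef W j ht, sum_ite_leftCount W j, mul_zero, zero_add,
      ← sqrt_mul_div_div hR.le hL (Nat.cast_nonneg _), mul_comm (rightCount W j (m - t) : ℝ)]
    ring

/-- If the square roots of the counts in a row are close to those of their expectations, then so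
is the CUSUM curve of the mean. -/
theorem abs_cusum_meanMatrix_sub_le {z t : ℕ} (μ₁ μ₂ : EuclideanSpace ℝ (Fin p)) (ht : t ≤ m)
    (hz : z ≤ m) {q x : ℝ} (hq : 0 < q)
    (hx : ∀ t ≤ m, |Real.sqrt (leftCount W j t) - Real.sqrt (q * t)| ≤ x ∧
      |Real.sqrt (rightCount W j t) - Real.sqrt (q * t)| ≤ x) :
    |∑ r, cusumCoef W j t r * meanMatrix m z μ₁ μ₂ j r -
        (μ₂ j - μ₁ j) * Real.sqrt q * cusumCurve m z t| ≤ |μ₂ j - μ₁ j| * (5 * x) := by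
  have hmono : ∀ {a b : ℕ}, a ≤ b → Real.sqrt (a : ℝ) ≤ Real.sqrt (b : ℝ) := fun h =>
    Real.sqrt_le_sqrt (by exact_mod_cast h)
  have hmul : ∀ {a b : ℕ}, a ≤ b → Real.sqrt (q * a) ≤ Real.sqrt (q * b) := fun h =>
    Real.sqrt_le_sqrt (mul_le_mul_of_nonneg_left (by exact_mod_cast h) hq.le)
  have hsum := leftCount_add_rightCount W j ht
  rw [sum_cusumCoef_mul_meanMatrix W j μ₁ μ₂ ht hz, mul_assoc, ← mul_sub, abs_mul]
  refine mul_le_mul_of_nonneg_left ?_ (abs_nonneg _)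
  unfold cusumCurve
  split_ifs with htz
  · rw [← cusumShape_smul (Real.sqrt_pos.mpr hq)]
    simp only [← Real.sqrt_mul hq.le]
    exact abs_cusumShape_sub_le (Real.sqrt_nonneg _) (Real.sqrt_nonneg _)
      (hmono (rightCount_mono W j (by omega))) (hmono (by omega)) (hmono (by omega))
      (Real.sqrt_nonneg _) (Real.sqrt_nonneg _) (hmul (by omega)) (hmul (by omega))
      (hmul (by omega)) (hx t ht).1 (hx (m - z) (by omega)).2 (hx (m - t) (by omega)).2
      (hx m le_rfl).1
  · rw [← cusumShape_smul (Real.sqrt_pos.mpr hq)]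
    simp only [← Real.sqrt_mul hq.le]
    exact abs_cusumShape_sub_le (Real.sqrt_nonneg _) (Real.sqrt_nonneg _)
      (hmono (leftCount_mono W j (by omega))) (hmono (by omega)) (hmono (by omega))
      (Real.sqrt_nonneg _) (Real.sqrt_nonneg _) (hmul (by omega)) (hmul (by omega))
      (hmul (by omega)) (hx (m - t) (by omega)).2 (hx z (by omega)).1 (hx t ht).1
      (hx m le_rfl).1

end

/-! ### The penalised optimisation problem -/

theorem abs_sum_mul_le_sqrt {ι : Type*} (s : Finset ι) (f g : ι → ℝ) :
    |∑ i ∈ s, f i * g i| ≤ Real.sqrt (∑ i ∈ s, f i ^ 2) * Real.sqrt (∑ i ∈ s, g i ^ 2) := by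
  rw [← Real.sqrt_mul (Finset.sum_nonneg fun i _ => sq_nonneg _)]
  exact Real.abs_le_sqrt (Finset.sum_mul_sq_le_sq_mul_sq s f g)

theorem sum_abs_le_sqrt_card_mul {ι : Type*} (s : Finset ι) (f : ι → ℝ) :
    ∑ i ∈ s, |f i| ≤ Real.sqrt s.card * Real.sqrt (∑ i ∈ s, f i ^ 2) := by
  have h := abs_sum_mul_le_sqrt s (fun _ => 1) (fun i => |f i|)
  simp only [one_mul, one_pow, Finset.sum_const, nsmul_eq_mul, mul_one, sq_abs] at h
  exact (le_abs_self _).trans h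

theorem sqrt_sum_sq_le_one {ι : Type*} [Fintype ι] {v : EuclideanSpace ℝ ι} (hv : ‖v‖ ≤ 1) :
    Real.sqrt (∑ i, v i ^ 2) ≤ 1 := by
  rw [EuclideanSpace.norm_eq] at hv
  simpa using hv

theorem sum_abs_le_sqrt_card {k : ℕ} {w : EuclideanSpace ℝ (Fin k)} (hw : ‖w‖ ≤ 1) :
    ∑ i, |w i| ≤ Real.sqrt k := by
  have h := sum_abs_le_sqrt_card_mul Finset.univ (fun i => w i)
  rw [Finset.card_univ, Fintype.card_fin] at h
  exact h.trans (mul_le_of_le_one_right (Real.sqrt_nonneg _) (sqrt_sum_sq_le_one hw))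

/-- Entrywise bounds are paired with `‖w‖₁ ≤ √k`. Keeping a separate bound for each row lets the
error weights `|θ j|` be summed by Cauchy–Schwarz later. -/
theorem abs_bilinear_le {p k : ℕ} {E : Fin p → Fin k → ℝ} {b : Fin p → ℝ}
    (hE : ∀ j i, |E j i| ≤ b j) (hb : ∀ j, 0 ≤ b j) (v : EuclideanSpace ℝ (Fin p))
    {w : EuclideanSpace ℝ (Fin k)} (hw : ‖w‖ ≤ 1) :
    |∑ j, ∑ i, E j i * (v j * w i)| ≤ Real.sqrt k * ∑ j, b j * |v j| := by
  calc |∑ j, ∑ i, E j i * (v j * w i)| ≤ ∑ j, ∑ i, |E j i * (v j * w i)| :=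
        (Finset.abs_sum_le_sum_abs _ _).trans
          (Finset.sum_le_sum fun j _ => Finset.abs_sum_le_sum_abs _ _)
    _ ≤ ∑ j, ∑ i, b j * |v j| * |w i| := by
        refine Finset.sum_le_sum fun j _ => Finset.sum_le_sum fun i _ => ?_
        rw [abs_mul, abs_mul, ← mul_assoc]
        exact mul_le_mul_of_nonneg_right
          (mul_le_mul_of_nonneg_right (hE j i) (abs_nonneg _)) (abs_nonneg _)
    _ = (∑ j, b j * |v j|) * ∑ i, |w i| := by
        rw [Finset.sum_mul]
        exact Finset.sum_congr rfl fun j _ => (Finset.mul_sum _ _ _).symm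
    _ ≤ (∑ j, b j * |v j|) * Real.sqrt k :=
        mul_le_mul_of_nonneg_left (sum_abs_le_sqrt_card hw)
          (Finset.sum_nonneg fun j _ => mul_nonneg (hb j) (abs_nonneg _))
    _ = _ := mul_comm _ _

theorem sum_abs_mul_le_norm {p : ℕ} (θ : EuclideanSpace ℝ (Fin p)) {v : EuclideanSpace ℝ (Fin p)}
    (hv : ‖v‖ ≤ 1) : ∑ j, |θ j| * |v j| ≤ ‖θ‖ := by
  have h := (le_abs_self _).trans
    (abs_sum_mul_le_sqrt Finset.univ (fun j => |θ j|) fun j => |v j|)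
  simp only [sq_abs] at h
  refine h.trans ?_
  rw [EuclideanSpace.norm_eq θ]
  simp only [Real.norm_eq_abs, sq_abs]
  exact mul_le_of_le_one_right (Real.sqrt_nonneg _) (sqrt_sum_sq_le_one hv)

/-- A near rank-one matrix: the bilinear form up to an additive error. -/
theorem abs_bilinear_sub_rankOne_le {p k : ℕ} {T A : Fin p → Fin k → ℝ}
    {u : Fin p → ℝ} {θ : EuclideanSpace ℝ (Fin p)} {g : Fin k → ℝ} {lam η δ : ℝ}
    (hη : ∀ j i, |T j i - A j i| ≤ η) (hη0 : 0 ≤ η) (hlam : Real.sqrt k * η ≤ lam)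
    (hA : ∀ j i, |A j i - u j * g i| ≤ |θ j| * δ) (hδ : 0 ≤ δ)
    {v : EuclideanSpace ℝ (Fin p)} {w : EuclideanSpace ℝ (Fin k)} (hv : ‖v‖ ≤ 1) (hw : ‖w‖ ≤ 1) :
    |∑ j, ∑ i, T j i * (v j * w i) - (∑ j, v j * u j) * ∑ i, w i * g i| ≤
      lam * ∑ j, |v j| + Real.sqrt k * δ * ‖θ‖ := by
  have h1 := abs_bilinear_le (E := fun j i => T j i - A j i) (b := fun _ => η) hη
    (fun _ => hη0) v hw
  have h2 := abs_bilinear_le (E := fun j i => A j i - u j * g i) (b := fun j => |θ j| * δ) hA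
    (fun _ => mul_nonneg (abs_nonneg _) hδ) v hw
  have hid : ∑ j, ∑ i, T j i * (v j * w i) - (∑ j, v j * u j) * ∑ i, w i * g i =
      ∑ j, ∑ i, (T j i - A j i) * (v j * w i) +
        ∑ j, ∑ i, (A j i - u j * g i) * (v j * w i) := by
    rw [Finset.sum_mul_sum, ← Finset.sum_sub_distrib, ← Finset.sum_add_distrib]
    refine Finset.sum_congr rfl fun j _ => ?_
    rw [← Finset.sum_sub_distrib, ← Finset.sum_add_distrib]
    exact Finset.sum_congr rfl fun i _ => by ring
  rw [hid]
  refine (abs_add_le _ _).trans (add_le_add (h1.trans ?_) (h2.trans ?_))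
  · rw [← Finset.mul_sum, ← mul_assoc]
    exact mul_le_mul_of_nonneg_right hlam (Finset.sum_nonneg fun _ _ => abs_nonneg _)
  · rw [mul_assoc]
    refine mul_le_mul_of_nonneg_left ?_ (Real.sqrt_nonneg _)
    calc ∑ j, |θ j| * δ * |v j| = δ * ∑ j, |θ j| * |v j| := by
          rw [Finset.mul_sum]; exact Finset.sum_congr rfl fun j _ => by ring
      _ ≤ δ * ‖θ‖ := mul_le_mul_of_nonneg_left (sum_abs_mul_le_norm θ hv) hδ

theorem norm_normalize {k : ℕ} (g : Fin k → ℝ) (hG : 0 < Real.sqrt (∑ i, g i ^ 2)) :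
    ‖(WithLp.toLp 2 fun i => g i / Real.sqrt (∑ i, g i ^ 2) : EuclideanSpace ℝ (Fin k))‖ ≤ 1 := by
  rw [EuclideanSpace.norm_eq]
  simp only [Real.norm_eq_abs, sq_abs, div_pow, ← Finset.sum_div,
    Real.sq_sqrt (Finset.sum_nonneg fun i _ => sq_nonneg (g i))]
  rw [div_self (Real.sqrt_pos.mp hG).ne', Real.sqrt_one]

/-- The optimal projection direction is aligned with the signal direction. -/
theorem alignment_of_mem_argmaxSet {p k s : ℕ} {T A : Fin p → Fin k → ℝ}
    {u : Fin p → ℝ} {θ : EuclideanSpace ℝ (Fin p)} {g : Fin k → ℝ} {lam η δ : ℝ}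
    {vw : EuclideanSpace ℝ (Fin p) × EuclideanSpace ℝ (Fin k)} (hvw : vw ∈ argmaxSet lam T)
    (hη : ∀ j i, |T j i - A j i| ≤ η) (hη0 : 0 ≤ η) (hlam : Real.sqrt k * η ≤ lam)
    (hA : ∀ j i, |A j i - u j * g i| ≤ |θ j| * δ) (hδ : 0 ≤ δ)
    (hu : (Finset.univ.filter fun j => u j ≠ 0).card ≤ s)
    (hU : 0 < Real.sqrt (∑ j, u j ^ 2)) (hG : 0 < Real.sqrt (∑ i, g i ^ 2)) :
    Real.sqrt (∑ j, u j ^ 2) * Real.sqrt (∑ i, g i ^ 2) - 2 * (Real.sqrt k * δ * ‖θ‖) -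
        2 * (lam * Real.sqrt s) ≤
      |∑ j, vw.1 j * u j| * Real.sqrt (∑ i, g i ^ 2) := by
  obtain ⟨hmem, hmax⟩ := hvw
  have hv : ‖vw.1‖ ≤ 1 := by simpa using hmem.1
  have hw : ‖vw.2‖ ≤ 1 := by simpa using hmem.2
  set U := Real.sqrt (∑ j, u j ^ 2) with hUdef
  set G := Real.sqrt (∑ i, g i ^ 2) with hGdef
  have hlam0 : 0 ≤ lam := le_trans (by positivity) hlam
  -- The comparison pair is formed by the normalised factors of the rank-one signal. Its first
  -- vector is supported where `u` is, so its penalty is at most `lam * √s`.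
  let v₀ : EuclideanSpace ℝ (Fin p) := WithLp.toLp 2 fun j => u j / U
  let w₀ : EuclideanSpace ℝ (Fin k) := WithLp.toLp 2 fun i => g i / G
  have hv₀ : ‖v₀‖ ≤ 1 := norm_normalize u hU
  have hw₀ : ‖w₀‖ ≤ 1 := norm_normalize g hG
  have hle : objective lam T (v₀, w₀) ≤ objective lam T vw :=
    hmax ⟨by simpa using hv₀, by simpa using hw₀⟩
  -- At the maximiser the noise term `lam * ‖v‖₁` cancels against the penalty. At the comparison
  -- pair noise and penalty add up, whence `2 * (lam * √s)`.
  have hb := (abs_le.mp (abs_bilinear_sub_rankOne_le hη hη0 hlam hA hδ hv hw)).2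
  have hb₀ := (abs_le.mp (abs_bilinear_sub_rankOne_le hη hη0 hlam hA hδ hv₀ hw₀)).1
  have hnorm : ∀ {q : ℕ} (f : Fin q → ℝ), 0 < Real.sqrt (∑ i, f i ^ 2) →
      ∑ i, f i / Real.sqrt (∑ i, f i ^ 2) * f i = Real.sqrt (∑ i, f i ^ 2) := by
    intro q f hf
    have : ∑ i, f i / Real.sqrt (∑ i, f i ^ 2) * f i =
        (∑ i, f i ^ 2) / Real.sqrt (∑ i, f i ^ 2) := by
      rw [Finset.sum_div]; exact Finset.sum_congr rfl fun i _ => by ring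
    rw [this, Real.div_sqrt]
  have e1 : ∑ j, v₀ j * u j = U := hnorm u hU
  have e2 : ∑ i, w₀ i * g i = G := hnorm g hG
  have hℓ1 : ∑ j, |v₀ j| ≤ Real.sqrt s := by
    have h1 : ∑ j, |v₀ j| = ∑ j ∈ Finset.univ.filter fun j => u j ≠ 0, |v₀ j| := by
      rw [Finset.sum_filter]
      refine Finset.sum_congr rfl fun j _ => ?_
      by_cases h : u j = 0 <;> simp [v₀, h]
    rw [h1]
    refine (sum_abs_le_sqrt_card_mul _ _).trans ?_
    have h2 : Real.sqrt (∑ j ∈ Finset.univ.filter fun j => u j ≠ 0, v₀ j ^ 2) ≤ 1 :=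
      (Real.sqrt_le_sqrt (Finset.sum_le_sum_of_subset_of_nonneg (Finset.subset_univ _)
        fun _ _ _ => sq_nonneg _)).trans (sqrt_sum_sq_le_one hv₀)
    exact (mul_le_of_le_one_right (Real.sqrt_nonneg _) h2).trans
      (Real.sqrt_le_sqrt (by exact_mod_cast hu))
  have hcs : |∑ i, vw.2 i * g i| ≤ G :=
    (abs_sum_mul_le_sqrt _ _ _).trans
      (mul_le_of_le_one_left (Real.sqrt_nonneg _) (sqrt_sum_sq_le_one hw))
  have hprod : (∑ j, vw.1 j * u j) * ∑ i, vw.2 i * g i ≤ |∑ j, vw.1 j * u j| * G := by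
    refine (le_abs_self _).trans ?_
    rw [abs_mul]
    exact mul_le_mul_of_nonneg_left hcs (abs_nonneg _)
  rw [e1, e2] at hb₀
  unfold objective at hle
  simp only at hle
  have hpen := mul_le_mul_of_nonneg_left hℓ1 hlam0
  linarith

/-! ### The peak of the projected series -/

theorem abs_median_sub_le {s : Finset ℕ} (hs : s.Nonempty) {c D : ℝ}
    (h : ∀ t ∈ s, |(t : ℝ) - c| ≤ D) : |median s - c| ≤ D := by
  have hcard := hs.card_pos
  have hmem : ∀ i < s.card, (s.sort).getD i 0 ∈ s := by
    intro i hi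
    rw [List.getD_eq_getElem _ _ (by simpa using hi)]
    exact (Finset.mem_sort (· ≤ ·)).mp (List.getElem_mem _)
  have h1 := abs_le.mp (h _ (hmem ((s.card - 1) / 2) (by omega)))
  have h2 := abs_le.mp (h _ (hmem (s.card / 2) (by omega)))
  unfold median
  rw [abs_le]
  constructor <;> linarith

theorem peakSet_nonempty {k : ℕ} (hk : 0 < k) (f : Fin k → ℝ) : (peakSet f).Nonempty := by
  obtain ⟨i, -, hi⟩ := Finset.exists_max_image Finset.univ (fun i => |f i|) ⟨⟨0, hk⟩, by simp⟩
  exact ⟨i.val + 1, Finset.mem_image.mpr ⟨i, by simpa using hi, rfl⟩⟩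

/-- If a series is close to a multiple of the CUSUM curve of a change after time `z`, then its
median peak is close to `z`. -/
theorem abs_median_peakSet_sub_le {m z : ℕ} (hz : 0 < z) (hzm : z < m) {f : Fin (m - 1) → ℝ}
    {β e : ℝ} (hβ : β ≠ 0) (hf : ∀ i, |f i - β * cusumCurve m z (i.val + 1)| ≤ e)
    (hsmall : 2 * e / |β| < Real.sqrt (min z (m - z) : ℕ) / 4) :
    |median (peakSet f) - z| ≤ 4 * Real.sqrt (min z (m - z) : ℕ) * (2 * e / |β|) := by
  refine abs_median_sub_le (peakSet_nonempty (by omega) f) fun t ht => ?_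
  obtain ⟨i, hi, rfl⟩ := Finset.mem_image.mp ht
  have hpeak : ∀ i', |f i'| ≤ |f i| := by simpa using hi
  have hi' := i.isLt
  refine cusumCurve_drop hz hzm (by omega) (by omega) ?_ hsmall
  -- Index `z - 1` is time `z`. The peak is at least as high there, and two errors `e` separate the
  -- series from the curve.
  have h1 := hpeak ⟨z - 1, by omega⟩
  have h2 := hf ⟨z - 1, by omega⟩
  have h3 := hf i
  simp only [Nat.sub_add_cancel hz] at h2
  rw [le_div_iff₀ (abs_pos.mpr hβ)]
  have h4 : |β| * cusumCurve m z z = |β * cusumCurve m z z| := by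
    rw [abs_mul, abs_of_nonneg (cusumCurve_nonneg _ _ _)]
  have h5 : |β| * cusumCurve m z (i.val + 1) = |β * cusumCurve m z (i.val + 1)| := by
    rw [abs_mul, abs_of_nonneg (cusumCurve_nonneg _ _ _)]
  have h6 := abs_sub_abs_le_abs_sub (β * cusumCurve m z z) (f ⟨z - 1, by omega⟩)
  have h7 := abs_sub_abs_le_abs_sub (f i) (β * cusumCurve m z (i.val + 1))
  rw [abs_sub_comm] at h6
  linarith

/-! ### The estimator on a good event -/

theorem missCusum_mask {p m : ℕ} (X : Fin p → Fin m → ℝ) (W : Fin p → Fin m → Bool) :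
    missCusum (mask X W) W =
      fun j (i : Fin (m - 1)) => ∑ r, cusumCoef W j (i.val + 1) r * X j r := by
  funext j i
  exact missCusumAt_mask_mask W j X _

/-- The noise part of the MissCUSUM transformation: its value minus its value at the mean. -/
noncomputable def cusumNoise {p m : ℕ} (a X : Fin p → Fin m → ℝ) (W : Fin p → Fin m → Bool)
    (j : Fin p) (i : Fin (m - 1)) : ℝ :=
  ∑ r, cusumCoef W j (i.val + 1) r * (X j r - a j r)

/-- In row `j`, the square roots of all initial and final counts are within `x` of the square
roots of their means. -/
def CountsClose {p m : ℕ} (q : Fin p → unitInterval) (x : ℝ) (W : Fin p → Fin m → Bool)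
    (j : Fin p) : Prop :=
  ∀ t ≤ m, |Real.sqrt (leftCount W j t) - Real.sqrt (q j * t)| ≤ x ∧
    |Real.sqrt (rightCount W j t) - Real.sqrt (q j * t)| ≤ x

/-- Rows without a change have mean exactly zero after the transformation, so counts need
controlling only on the support of `μ₂ - μ₁`. This keeps `p` out of the level `x`. -/
theorem abs_cusum_mean_sub_rankOne_le {p m z : ℕ} (hz : z ≤ m) {μ₁ μ₂ : EuclideanSpace ℝ (Fin p)}
    {q : Fin p → unitInterval} (hq : ∀ j, 0 < q j) {x : ℝ} {W : Fin p → Fin m → Bool}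
    (hW : ∀ j, (μ₂ - μ₁) j ≠ 0 → CountsClose q x W j) (j : Fin p) (i : Fin (m - 1)) :
    |∑ r, cusumCoef W j (i.val + 1) r * meanMatrix m z μ₁ μ₂ j r -
        (μ₂ - μ₁) j * Real.sqrt (q j) * cusumCurve m z (i.val + 1)| ≤
      |(μ₂ - μ₁) j| * (5 * x) := by
  have hi := i.isLt
  by_cases h : (μ₂ - μ₁) j = 0
  · have h' : μ₂ j - μ₁ j = 0 := h
    rw [sum_cusumCoef_mul_meanMatrix W j μ₁ μ₂ (by omega) hz, h, h']
    simp
  · exact abs_cusum_meanMatrix_sub_le W j μ₁ μ₂ (by omega) hz (by exact_mod_cast hq j) (hW j h)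

/-- The deterministic core: the first condition on the signal aligns the direction using the odd
half, the second locates the peak of the projected even half. -/
theorem abs_median_peakSet_project_sub_le {p m z s : ℕ} (hz : 0 < z) (hzm : z < m)
    {μ₁ μ₂ : EuclideanSpace ℝ (Fin p)} {q : Fin p → unitInterval} (hq : ∀ j, 0 < q j)
    {x η₁ η₂ lam : ℝ} (hx : 0 ≤ x) (hη₁ : 0 ≤ η₁) {X₁ X₂ : Fin p → Fin m → ℝ}
    {W₁ W₂ : Fin p → Fin m → Bool}
    {vw : EuclideanSpace ℝ (Fin p) × EuclideanSpace ℝ (Fin (m - 1))}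
    (hvw : vw ∈ argmaxSet lam (missCusum (mask X₁ W₁) W₁))
    (hW₁ : ∀ j, (μ₂ - μ₁) j ≠ 0 → CountsClose q x W₁ j)
    (hW₂ : ∀ j, (μ₂ - μ₁) j ≠ 0 → CountsClose q x W₂ j)
    (hX₁ : ∀ j i, |cusumNoise (meanMatrix m z μ₁ μ₂) X₁ W₁ j i| ≤ η₁)
    (hX₂ : ∀ i, |∑ j, vw.1 j * cusumNoise (meanMatrix m z μ₁ μ₂) X₂ W₂ j i| ≤ η₂)
    (hlam : Real.sqrt m * η₁ ≤ lam) (hs : sparsity (μ₂ - μ₁) ≤ s)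
    (hU : 0 < weightedNorm q (μ₂ - μ₁))
    (hsnr₁ : 2 * (Real.sqrt m * (5 * x) * ‖μ₂ - μ₁‖) + 2 * (lam * Real.sqrt s) ≤
      weightedNorm q (μ₂ - μ₁) * (min z (m - z) : ℕ) / 6)
    (hsnr₂ : 4 * (5 * x * ‖μ₂ - μ₁‖ + η₂) / weightedNorm q (μ₂ - μ₁) <
      Real.sqrt (min z (m - z) : ℕ) / 4) :
    |median (peakSet (project vw.1 (missCusum (mask X₂ W₂) W₂))) - z| ≤
      4 * Real.sqrt (min z (m - z) : ℕ) *
        (4 * (5 * x * ‖μ₂ - μ₁‖ + η₂) / weightedNorm q (μ₂ - μ₁)) := by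
  set θ := μ₂ - μ₁ with hθ
  set U := weightedNorm q θ with hUdef
  let u : Fin p → ℝ := fun j => θ j * Real.sqrt (q j)
  let g : Fin (m - 1) → ℝ := fun i => cusumCurve m z (i.val + 1)
  have hUu : Real.sqrt (∑ j, u j ^ 2) = U := by
    rw [hUdef, weightedNorm]
    congr 1
    refine Finset.sum_congr rfl fun j _ => ?_
    simp only [u]
    rw [mul_pow, Real.sq_sqrt (q j).2.1]
  have hκ : (0 : ℝ) < (min z (m - z) : ℕ) := by exact_mod_cast (by omega : 0 < min z (m - z))
  have hG : ((min z (m - z) : ℕ) : ℝ) / 3 ≤ Real.sqrt (∑ i, g i ^ 2) := by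
    refine Real.le_sqrt_of_sq_le ?_
    have := sum_cusumCurve_sq hz hzm
    rw [Finset.sum_range (fun i => cusumCurve m z (i + 1) ^ 2)] at this
    refine le_trans ?_ this
    rw [div_pow]
    have := sq_nonneg ((min z (m - z) : ℕ) : ℝ)
    linarith
  have hG0 : 0 < Real.sqrt (∑ i, g i ^ 2) := lt_of_lt_of_le (by positivity) hG
  have hm1 : Real.sqrt (m - 1 : ℕ) ≤ Real.sqrt m :=
    Real.sqrt_le_sqrt (by exact_mod_cast Nat.sub_le m 1)
  have halign := alignment_of_mem_argmaxSet (s := s) (u := u) (θ := θ) (g := g) (η := η₁)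
    (A := fun j i => ∑ r, cusumCoef W₁ j (i.val + 1) r * meanMatrix m z μ₁ μ₂ j r)
    (δ := 5 * x) hvw
    (fun j i => by
      refine le_trans (le_of_eq ?_) (hX₁ j i)
      rw [missCusum_mask, ← Finset.sum_sub_distrib, cusumNoise]
      simp only [mul_sub])
    hη₁ ((mul_le_mul_of_nonneg_right hm1 hη₁).trans hlam)
    (abs_cusum_mean_sub_rankOne_le hzm.le hq hW₁) (by linarith)
    (le_trans (Finset.card_le_card fun j hj => by
      simp only [Finset.mem_filter, Finset.mem_univ, true_and, u] at hj ⊢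
      exact left_ne_zero_of_mul hj) hs)
    (by rw [hUu]; exact hU) hG0
  rw [hUu] at halign
  set β := ∑ j, vw.1 j * u j with hβ
  -- Since the curve has norm at least a third of the shorter side, `hsnr₁` caps the loss in the
  -- alignment at half of the main term.
  have hβU : U / 2 ≤ |β| := by
    refine le_of_mul_le_mul_right ?_ hG0
    have h1 : Real.sqrt (m - 1 : ℕ) * (5 * x) * ‖θ‖ ≤ Real.sqrt m * (5 * x) * ‖θ‖ :=
      mul_le_mul_of_nonneg_right (mul_le_mul_of_nonneg_right hm1 (by linarith)) (norm_nonneg _)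
    have h2 := mul_le_mul_of_nonneg_left hG hU.le
    linarith
  have hβ0 : 0 < |β| := lt_of_lt_of_le (by linarith) hβU
  have hv : ‖vw.1‖ ≤ 1 := by simpa using hvw.1.1
  have hseries : ∀ i, |project vw.1 (missCusum (mask X₂ W₂) W₂) i -
      β * cusumCurve m z (i.val + 1)| ≤ 5 * x * ‖θ‖ + η₂ := by
    intro i
    have hid : project vw.1 (missCusum (mask X₂ W₂) W₂) i - β * cusumCurve m z (i.val + 1) =
        ∑ j, vw.1 j * (∑ r, cusumCoef W₂ j (i.val + 1) r * meanMatrix m z μ₁ μ₂ j r -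
          u j * cusumCurve m z (i.val + 1)) +
        ∑ j, vw.1 j * cusumNoise (meanMatrix m z μ₁ μ₂) X₂ W₂ j i := by
      rw [hβ, project, Finset.sum_mul, ← Finset.sum_sub_distrib, ← Finset.sum_add_distrib]
      refine Finset.sum_congr rfl fun j _ => ?_
      rw [missCusum_mask, cusumNoise]
      simp only [mul_sub, Finset.sum_sub_distrib]
      ring
    rw [hid]
    refine (abs_add_le _ _).trans (add_le_add ?_ (hX₂ i))
    calc |∑ j, vw.1 j * (∑ r, cusumCoef W₂ j (i.val + 1) r * meanMatrix m z μ₁ μ₂ j r -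
          u j * cusumCurve m z (i.val + 1))|
        ≤ ∑ j, |vw.1 j| * (|θ j| * (5 * x)) := by
          refine (Finset.abs_sum_le_sum_abs _ _).trans (Finset.sum_le_sum fun j _ => ?_)
          rw [abs_mul]
          exact mul_le_mul_of_nonneg_left (abs_cusum_mean_sub_rankOne_le hzm.le hq hW₂ j i)
            (abs_nonneg _)
      _ = 5 * x * ∑ j, |θ j| * |vw.1 j| := by
          rw [Finset.mul_sum]; exact Finset.sum_congr rfl fun j _ => by ring
      _ ≤ 5 * x * ‖θ‖ := mul_le_mul_of_nonneg_left (sum_abs_mul_le_norm θ hv) (by linarith)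
  have he0 : 0 ≤ 5 * x * ‖θ‖ + η₂ := (abs_nonneg _).trans (hseries ⟨0, by omega⟩)
  have hquot : 2 * (5 * x * ‖θ‖ + η₂) / |β| ≤ 4 * (5 * x * ‖θ‖ + η₂) / U := by
    rw [div_le_div_iff₀ hβ0 hU]
    nlinarith
  exact (abs_median_peakSet_sub_le hz hzm (abs_pos.mp hβ0) hseries
    (hquot.trans_lt hsnr₂)).trans (mul_le_mul_of_nonneg_left hquot (by positivity))

/-! ### Probabilities of the bad events -/

theorem card_filter_val_add_one_le {m t : ℕ} (ht : t ≤ m) :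
    (Finset.univ.filter fun r : Fin m => r.val + 1 ≤ t).card = t := by
  have : (Finset.univ.filter fun r : Fin m => r.val + 1 ≤ t) =
      Finset.univ.map (Fin.castLEEmb ht) := by
    ext r
    simp only [Finset.mem_filter, Finset.mem_univ, true_and, Finset.mem_map]
    exact ⟨fun h => ⟨⟨r, h⟩, Fin.ext rfl⟩, by rintro ⟨a, rfl⟩; exact a.isLt⟩
  rw [this, Finset.card_map, Finset.card_univ, Fintype.card_fin]

theorem card_filter_le_val_add_one_add {m t : ℕ} (ht : t ≤ m) :
    (Finset.univ.filter fun r : Fin m => m + 1 ≤ r.val + 1 + t).card = t := by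
  refine (Finset.card_bij (fun r _ => Fin.rev r) ?_ (fun _ _ _ _ h => Fin.rev_injective h) ?_).trans
    (card_filter_val_add_one_le ht)
  · intro r hr
    simp only [Finset.mem_filter, Finset.mem_univ, true_and, Fin.val_rev] at hr ⊢
    omega
  · intro r hr
    refine ⟨Fin.rev r, ?_, Fin.rev_rev r⟩
    simp only [Finset.mem_filter, Finset.mem_univ, true_and, Fin.val_rev] at hr ⊢
    omega

/-- Union bound over the rows in `J`, the `m + 1` times, the two directions of counting and the two
tails. -/
theorem measure_not_countsClose_le {p m : ℕ} (q : Fin p → unitInterval) (hq : ∀ j, 0 < q j)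
    {x : ℝ} (hx : 0 ≤ x) (J : Finset (Fin p)) :
    (Measure.pi fun j => Measure.pi fun _ : Fin m => bernoulliMeasure true false (q j))
        {W | ∃ j ∈ J, ¬ CountsClose q x W j} ≤
      ENNReal.ofReal (J.card * (m + 1) * (4 * Real.exp (-x ^ 2))) := by
  set B := Measure.pi fun j => Measure.pi fun _ : Fin m => bernoulliMeasure true false (q j)
  have hone : ∀ j, ∀ t ∈ Finset.range (m + 1),
      B ({W | x < |Real.sqrt (leftCount W j t) - Real.sqrt (q j * t)|} ∪
        {W | x < |Real.sqrt (rightCount W j t) - Real.sqrt (q j * t)|}) ≤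
      ENNReal.ofReal (4 * Real.exp (-x ^ 2)) := by
    intro j t ht
    have ht' : t ≤ m := by have := Finset.mem_range.mp ht; omega
    have h1 := sqrt_count_tail q j (hq j) (Finset.univ.filter fun r : Fin m => r.val + 1 ≤ t) hx
    have h2 := sqrt_count_tail q j (hq j)
      (Finset.univ.filter fun r : Fin m => m + 1 ≤ r.val + 1 + t) hx
    simp only [card_filter_val_add_one_le ht', Finset.filter_filter] at h1
    simp only [card_filter_le_val_add_one_add ht', Finset.filter_filter] at h2
    refine (measure_union_le _ _).trans ((add_le_add h1 h2).trans (le_of_eq ?_))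
    rw [← ENNReal.ofReal_add (by positivity) (by positivity)]
    ring_nf
  calc B {W | ∃ j ∈ J, ¬ CountsClose q x W j}
      ≤ B (⋃ j ∈ J, ⋃ t ∈ Finset.range (m + 1),
          ({W | x < |Real.sqrt (leftCount W j t) - Real.sqrt (q j * t)|} ∪
          {W | x < |Real.sqrt (rightCount W j t) - Real.sqrt (q j * t)|})) := by
        refine measure_mono ?_
        rintro W ⟨j, hj, hW⟩
        unfold CountsClose at hW
        push Not at hW
        obtain ⟨t, ht, hW⟩ := hW
        refine Set.mem_iUnion₂.mpr ⟨j, hj, Set.mem_iUnion₂.mpr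
          ⟨t, Finset.mem_range.mpr (by omega), ?_⟩⟩
        by_cases h : |Real.sqrt (leftCount W j t) - Real.sqrt (q j * t)| ≤ x
        · exact Or.inr (hW h)
        · exact Or.inl (not_le.mp h)
    _ ≤ ∑ j ∈ J, ∑ t ∈ Finset.range (m + 1), ENNReal.ofReal (4 * Real.exp (-x ^ 2)) :=
        (measure_biUnion_finset_le _ _).trans (Finset.sum_le_sum fun j _ =>
          (measure_biUnion_finset_le _ _).trans (Finset.sum_le_sum fun t ht => hone j t ht))
    _ = _ := by
        rw [Finset.sum_const, Finset.sum_const, Finset.card_range, nsmul_eq_mul, nsmul_eq_mul,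
          ← ENNReal.ofReal_natCast, ← ENNReal.ofReal_natCast,
          ← ENNReal.ofReal_mul (Nat.cast_nonneg _), ← ENNReal.ofReal_mul (Nat.cast_nonneg _)]
        push_cast
        ring_nf

/-- Tail of a projection of the noise. -/
theorem measure_project_cusumNoise_le {p m : ℕ} (a : Fin p → Fin m → ℝ) {σ y : ℝ} (hσ : 0 < σ)
    (hy : 0 < y) (W : Fin p → Fin m → Bool) {v : Fin p → ℝ} (hv : ∑ j, v j ^ 2 ≤ 1)
    (i : Fin (m - 1)) :
    (Measure.pi fun j => Measure.pi fun r => gaussianReal (a j r) (Real.toNNReal (σ ^ 2)))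
        {X | σ * y < |∑ j, v j * cusumNoise a X W j i|} ≤
      ENNReal.ofReal (2 * Real.exp (-(y ^ 2 / 2))) := by
  have hi := i.isLt
  have h := gaussian_linear_tail a (fun j r => v j * cusumCoef W j (i.val + 1) r) hσ hy (by
    refine le_trans (Finset.sum_le_sum fun j _ => ?_) hv
    simp only [mul_pow, ← Finset.mul_sum]
    exact mul_le_of_le_one_right (sq_nonneg _) (sum_cusumCoef_sq_le W j (by omega)))
  simpa only [cusumNoise, Finset.mul_sum, mul_assoc] using h

theorem measure_cusumNoise_le {p m : ℕ} (a : Fin p → Fin m → ℝ) {σ y : ℝ} (hσ : 0 < σ)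
    (hy : 0 < y) (W : Fin p → Fin m → Bool) (j : Fin p) (i : Fin (m - 1)) :
    (Measure.pi fun j => Measure.pi fun r => gaussianReal (a j r) (Real.toNNReal (σ ^ 2)))
        {X | σ * y < |cusumNoise a X W j i|} ≤
      ENNReal.ofReal (2 * Real.exp (-(y ^ 2 / 2))) := by
  have h := measure_project_cusumNoise_le a hσ hy W (v := Pi.single j 1)
    (by simp [Pi.single_apply, ite_pow]) i
  simpa [Pi.single_apply] using h

/-- There are finitely many revelation matrices, and for each of them the map is affine in the data.
-/
theorem measurable_cusumNoise {p m : ℕ} (a : Fin p → Fin m → ℝ) (j : Fin p) (i : Fin (m - 1)) :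
    Measurable fun d : (Fin p → Fin m → ℝ) × (Fin p → Fin m → Bool) =>
      cusumNoise a d.1 d.2 j i := by
  refine measurable_from_prod_countable_left fun W => ?_
  unfold cusumNoise
  fun_prop

theorem measurable_missCusum_mask {p m : ℕ} :
    Measurable fun d : (Fin p → Fin m → ℝ) × (Fin p → Fin m → Bool) =>
      missCusum (mask d.1 d.2) d.2 := by
  refine measurable_from_prod_countable_left fun W => ?_
  simp only [missCusum_mask]
  fun_prop

/-! ### The law of the two half-samples -/

/-- The law of the data and revelation matrices, rearranged into odd and even columns. -/
noncomputable def splitLaw {p : ℕ} (m z : ℕ) (μ₁ μ₂ : EuclideanSpace ℝ (Fin p)) (σ : ℝ)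
    (q : Fin p → unitInterval) :
    Measure (((Fin p → Fin m → ℝ) × (Fin p → Fin m → ℝ)) ×
      ((Fin p → Fin m → Bool) × (Fin p → Fin m → Bool))) :=
  let G := Measure.pi fun j => Measure.pi fun r =>
    gaussianReal (meanMatrix m z μ₁ μ₂ j r) (Real.toNNReal (σ ^ 2))
  let B := Measure.pi fun j => Measure.pi fun _ => bernoulliMeasure true false (q j)
  (G.prod G).prod (B.prod B)

/-- Because `z` is even, both halves have their change after time `z / 2`, so they are independent
and identically distributed. -/
theorem measurePreserving_changepointLaw {p n z : ℕ} (hn : Even n) (hz : Even z)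
    (μ₁ μ₂ : EuclideanSpace ℝ (Fin p)) (σ : ℝ) (q : Fin p → unitInterval) :
    MeasurePreserving
      (fun d : (Fin p → Fin n → ℝ) × (Fin p → Fin n → Bool) =>
        ((oddColumns d.1, evenColumns d.1), (oddColumns d.2, evenColumns d.2)))
      (changepointLaw n z μ₁ μ₂ σ q) (splitLaw (n / 2) (z / 2) μ₁ μ₂ σ q) := by
  have hz' := Nat.even_iff.mp hz
  have h1 := measurePreserving_split hn fun (j : Fin p) (r : Fin n) =>
    gaussianReal (meanMatrix n z μ₁ μ₂ j r) (Real.toNNReal (σ ^ 2))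
  have h2 := measurePreserving_split hn fun (j : Fin p) (_ : Fin n) =>
    bernoulliMeasure true false (q j)
  have ho : (oddColumns fun (j : Fin p) (r : Fin n) =>
      gaussianReal (meanMatrix n z μ₁ μ₂ j r) (Real.toNNReal (σ ^ 2))) =
      fun j r => gaussianReal (meanMatrix (n / 2) (z / 2) μ₁ μ₂ j r) (Real.toNNReal (σ ^ 2)) := by
    funext j r
    simp only [oddColumns, meanMatrix]
    congr 1
    exact if_congr (by omega) rfl rfl
  have he : (evenColumns fun (j : Fin p) (r : Fin n) =>
      gaussianReal (meanMatrix n z μ₁ μ₂ j r) (Real.toNNReal (σ ^ 2))) =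
      fun j r => gaussianReal (meanMatrix (n / 2) (z / 2) μ₁ μ₂ j r) (Real.toNNReal (σ ^ 2)) := by
    funext j r
    simp only [evenColumns, meanMatrix]
    congr 1
    exact if_congr (by omega) rfl rfl
  rw [ho, he] at h1
  exact h1.prod h2

theorem measurable_direction_apply {p m : ℕ}
    {v : (Fin p → Fin (m - 1) → ℝ) → EuclideanSpace ℝ (Fin p)} (hv : Measurable v) (j : Fin p) :
    Measurable fun d : ((Fin p → Fin m → ℝ) × (Fin p → Fin m → ℝ)) ×
        ((Fin p → Fin m → Bool) × (Fin p → Fin m → Bool)) =>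
      v (missCusum (mask d.1.1 d.2.1) d.2.1) j := by
  have h1 : Measurable fun d : ((Fin p → Fin m → ℝ) × (Fin p → Fin m → ℝ)) ×
      ((Fin p → Fin m → Bool) × (Fin p → Fin m → Bool)) => (d.1.1, d.2.1) := by fun_prop
  have h2 : Measurable fun u : EuclideanSpace ℝ (Fin p) => u j := by fun_prop
  have h3 := (h2.comp hv).comp (measurable_missCusum_mask (p := p) (m := m))
  exact h3.comp h1

theorem measurable_evenNoise {p m : ℕ} (a : Fin p → Fin m → ℝ) (j : Fin p) (i : Fin (m - 1)) :
    Measurable fun d : ((Fin p → Fin m → ℝ) × (Fin p → Fin m → ℝ)) ×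
        ((Fin p → Fin m → Bool) × (Fin p → Fin m → Bool)) => cusumNoise a d.1.2 d.2.2 j i := by
  have h1 : Measurable fun d : ((Fin p → Fin m → ℝ) × (Fin p → Fin m → ℝ)) ×
      ((Fin p → Fin m → Bool) × (Fin p → Fin m → Bool)) => (d.1.2, d.2.2) := by fun_prop
  have h2 := measurable_cusumNoise a j i
  have h := h2.comp h1
  exact h

section

variable {p m z : ℕ} (μ₁ μ₂ : EuclideanSpace ℝ (Fin p)) {σ : ℝ} (q : Fin p → unitInterval)

theorem splitLaw_not_countsClose_le (hq : ∀ j, 0 < q j) {x : ℝ} (hx : 0 ≤ x)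
    (J : Finset (Fin p)) :
    splitLaw m z μ₁ μ₂ σ q {d | ∃ j ∈ J, ¬ CountsClose q x d.2.1 j} ≤
        ENNReal.ofReal (J.card * (m + 1) * (4 * Real.exp (-x ^ 2))) ∧
      splitLaw m z μ₁ μ₂ σ q {d | ∃ j ∈ J, ¬ CountsClose q x d.2.2 j} ≤
        ENNReal.ofReal (J.card * (m + 1) * (4 * Real.exp (-x ^ 2))) := by
  have hS : MeasurableSet {W : Fin p → Fin m → Bool | ∃ j ∈ J, ¬ CountsClose q x W j} :=
    (Set.toFinite _).measurableSet
  have hB := measure_not_countsClose_le (m := m) q hq hx J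
  constructor
  · refine prod_apply_le_of_forall_fst _ _ (hS.preimage (measurable_fst.comp measurable_snd))
      fun _ => ?_
    exact prod_apply_le_of_forall_snd _ _ (hS.preimage measurable_fst) fun _ => hB
  · refine prod_apply_le_of_forall_fst _ _ (hS.preimage (measurable_snd.comp measurable_snd))
      fun _ => ?_
    exact prod_apply_le_of_forall_fst _ _ (hS.preimage measurable_snd) fun _ => hB

theorem splitLaw_cusumNoise_le (hσ : 0 < σ) {y : ℝ} (hy : 0 < y) :
    splitLaw m z μ₁ μ₂ σ q
        (⋃ j, ⋃ i, {d | σ * y < |cusumNoise (meanMatrix m z μ₁ μ₂) d.1.1 d.2.1 j i|}) ≤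
      ENNReal.ofReal (p * m * (2 * Real.exp (-(y ^ 2 / 2)))) := by
  have hone : ∀ j i, splitLaw m z μ₁ μ₂ σ q
      {d | σ * y < |cusumNoise (meanMatrix m z μ₁ μ₂) d.1.1 d.2.1 j i|} ≤
      ENNReal.ofReal (2 * Real.exp (-(y ^ 2 / 2))) := by
    intro j i
    have hmeas : Measurable fun d : ((Fin p → Fin m → ℝ) × (Fin p → Fin m → ℝ)) ×
        ((Fin p → Fin m → Bool) × (Fin p → Fin m → Bool)) =>
        |cusumNoise (meanMatrix m z μ₁ μ₂) d.1.1 d.2.1 j i| :=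
      ((measurable_cusumNoise (meanMatrix m z μ₁ μ₂) j i).comp
        ((measurable_fst.comp measurable_fst).prodMk (measurable_fst.comp measurable_snd))).abs
    have hS := measurableSet_lt (measurable_const (a := σ * y)) hmeas
    refine prod_apply_le_of_forall_snd _ _ hS fun W => ?_
    refine prod_apply_le_of_forall_snd _ _ (hS.preimage measurable_prodMk_right) fun _ => ?_
    exact measure_cusumNoise_le (meanMatrix m z μ₁ μ₂) hσ hy W.1 j i
  calc _ ≤ ∑ j : Fin p, ∑ i : Fin (m - 1), ENNReal.ofReal (2 * Real.exp (-(y ^ 2 / 2))) :=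
        (measure_iUnion_fintype_le _ _).trans (Finset.sum_le_sum fun j _ =>
          (measure_iUnion_fintype_le _ _).trans (Finset.sum_le_sum fun i _ => hone j i))
    _ = ENNReal.ofReal (p * ((m - 1 : ℕ) * (2 * Real.exp (-(y ^ 2 / 2))))) := by
        simp only [Finset.sum_const, Finset.card_univ, Fintype.card_fin, nsmul_eq_mul]
        rw [← ENNReal.ofReal_natCast, ← ENNReal.ofReal_natCast,
          ← ENNReal.ofReal_mul (Nat.cast_nonneg _), ← ENNReal.ofReal_mul (Nat.cast_nonneg _)]
    _ ≤ _ := by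
        refine ENNReal.ofReal_le_ofReal ?_
        rw [mul_assoc]
        have : ((m - 1 : ℕ) : ℝ) ≤ m := by exact_mod_cast Nat.sub_le m 1
        gcongr

/-- The point of sample splitting: once the odd data and both revelation matrices are frozen, the
direction is a fixed vector in the unit ball while the even data remain Gaussian. Only the `m - 1`
split points enter the union bound. -/
theorem splitLaw_project_cusumNoise_le (hσ : 0 < σ) {y : ℝ} (hy : 0 < y)
    {v : (Fin p → Fin (m - 1) → ℝ) → EuclideanSpace ℝ (Fin p)} (hv : Measurable v)
    (hv1 : ∀ T, ‖v T‖ ≤ 1) :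
    splitLaw m z μ₁ μ₂ σ q
        (⋃ i, {d | σ * y < |∑ j, v (missCusum (mask d.1.1 d.2.1) d.2.1) j *
          cusumNoise (meanMatrix m z μ₁ μ₂) d.1.2 d.2.2 j i|}) ≤
      ENNReal.ofReal (m * (2 * Real.exp (-(y ^ 2 / 2)))) := by
  have hone : ∀ i, splitLaw m z μ₁ μ₂ σ q
      {d | σ * y < |∑ j, v (missCusum (mask d.1.1 d.2.1) d.2.1) j *
          cusumNoise (meanMatrix m z μ₁ μ₂) d.1.2 d.2.2 j i|} ≤
      ENNReal.ofReal (2 * Real.exp (-(y ^ 2 / 2))) := by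
    intro i
    have hmeas : Measurable fun d : ((Fin p → Fin m → ℝ) × (Fin p → Fin m → ℝ)) ×
        ((Fin p → Fin m → Bool) × (Fin p → Fin m → Bool)) =>
        |∑ j, v (missCusum (mask d.1.1 d.2.1) d.2.1) j *
          cusumNoise (meanMatrix m z μ₁ μ₂) d.1.2 d.2.2 j i| := by
      refine (Finset.measurable_sum _ fun j _ => Measurable.mul ?_ ?_).abs
      · exact measurable_direction_apply hv j
      · exact measurable_evenNoise (meanMatrix m z μ₁ μ₂) j i
    have hS := measurableSet_lt (measurable_const (a := σ * y)) hmeas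
    refine prod_apply_le_of_forall_snd _ _ hS fun W => ?_
    refine prod_apply_le_of_forall_fst _ _ (hS.preimage measurable_prodMk_right) fun X => ?_
    refine measure_project_cusumNoise_le (meanMatrix m z μ₁ μ₂) hσ hy W.2
      (v := fun j => v (missCusum (mask X W.1) W.1) j) ?_ i
    have := sqrt_sum_sq_le_one (hv1 (missCusum (mask X W.1) W.1))
    rwa [Real.sqrt_le_one] at this
  calc _ ≤ ∑ i : Fin (m - 1), ENNReal.ofReal (2 * Real.exp (-(y ^ 2 / 2))) :=
        (measure_iUnion_fintype_le _ _).trans (Finset.sum_le_sum fun i _ => hone i)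
    _ = ENNReal.ofReal ((m - 1 : ℕ) * (2 * Real.exp (-(y ^ 2 / 2)))) := by
        simp only [Finset.sum_const, Finset.card_univ, Fintype.card_fin, nsmul_eq_mul]
        rw [← ENNReal.ofReal_natCast, ← ENNReal.ofReal_mul (Nat.cast_nonneg _)]
    _ ≤ _ := by
        refine ENNReal.ofReal_le_ofReal ?_
        have : ((m - 1 : ℕ) : ℝ) ≤ m := by exact_mod_cast Nat.sub_le m 1
        gcongr

end

theorem exp_neg_two_mul_log {a : ℝ} (ha : 0 < a) : Real.exp (-(2 * Real.log a)) = (a ^ 2)⁻¹ := by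
  rw [Real.exp_neg, two_mul, Real.exp_add, Real.exp_log ha, pow_two]

/-- The total probability of the bad events. -/
theorem tail_sum_le {n m s p : ℝ} (hm1 : m + 1 ≤ n) (hm : 0 ≤ m) (hs : 1 ≤ s) (hp : 1 ≤ p) :
    s * (m + 1) * (4 * ((s * n) ^ 2)⁻¹) + s * (m + 1) * (4 * ((s * n) ^ 2)⁻¹) +
      p * m * (2 * ((p * n) ^ 2)⁻¹) + m * (2 * ((s * n) ^ 2)⁻¹) ≤ 22 / n := by
  have hn : 0 < n := by linarith
  have h : ∀ a b : ℝ, 1 ≤ a → b ≤ n → a * b * ((a * n) ^ 2)⁻¹ ≤ 1 / n := by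
    intro a b ha hb
    have ha0 : 0 < a := by linarith
    rw [← div_eq_mul_inv, div_le_div_iff₀ (by positivity) hn, one_mul]
    calc a * b * n ≤ a * n * n := by gcongr
      _ ≤ a * (a * n * n) := le_mul_of_one_le_left (by positivity) ha
      _ = _ := by ring
  have h1 := h s (m + 1) hs hm1
  have h2 := h p m hp (by linarith)
  have h3 : m * ((s * n) ^ 2)⁻¹ ≤ s * m * ((s * n) ^ 2)⁻¹ := by
    rw [mul_assoc s]
    exact le_mul_of_one_le_left (by positivity) hs
  have h4 := h s m hs (by linarith)
  have h5 : 22 / n = 22 * (1 / n) := by ring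
  have h6 : 0 ≤ 1 / n := by positivity
  rw [h5]
  linarith

/-! ### Consequences of the signal-to-noise condition -/

theorem snr_clear_denominators {n κ U Θ τ Λ b : ℝ} (hn : 0 < n) (hκ : 0 < κ) (hU : 0 < U)
    (hτ : τ = 2 * κ / n)
    (h : 200 / τ * Real.sqrt (Λ / n) * (b / U + Θ / U) ≤ 1 / 2) :
    200 * (Real.sqrt n * Real.sqrt Λ * (b + Θ)) ≤ κ * U := by
  have hsq := Real.sq_sqrt hn.le
  have hn' : 0 < Real.sqrt n := Real.sqrt_pos.mpr hn
  rw [hτ, Real.sqrt_div' _ hn.le] at h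
  generalize Real.sqrt n = N at *
  subst hsq
  have : 200 / (2 * κ / N ^ 2) * (Real.sqrt Λ / N) * (b / U + Θ / U) =
      100 * (N * Real.sqrt Λ * (b + Θ)) / (κ * U) := by
    field_simp; ring
  rw [this, div_le_iff₀ (by positivity)] at h
  linarith

theorem sqrt_two_le : Real.sqrt 2 ≤ 3 / 2 := by
  rw [Real.sqrt_le_left (by norm_num)]; norm_num

theorem snr_alignment {n m κ U Θ ℓ Λ σ s : ℝ} (hn : n = 2 * m) (hm : 0 < m) (hκ : 0 < κ)
    (hU : 0 < U) (hΘ : 0 ≤ Θ) (hℓΛ : ℓ ≤ Λ) (hσ : 0 < σ)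
    (h : 200 * (Real.sqrt n * Real.sqrt Λ * (σ * Real.sqrt s + Θ)) ≤ κ * U) :
    2 * (Real.sqrt m * (5 * Real.sqrt (2 * ℓ)) * Θ) +
        2 * (2 * σ * Real.sqrt (n * Λ) * Real.sqrt s) ≤ U * κ / 6 := by
  have e1 : Real.sqrt m * Real.sqrt (2 * ℓ) = Real.sqrt n * Real.sqrt ℓ := by
    rw [← Real.sqrt_mul hm.le, ← Real.sqrt_mul (by linarith), hn]
    congr 1; ring
  have e2 : Real.sqrt (n * Λ) = Real.sqrt n * Real.sqrt Λ := Real.sqrt_mul (by linarith) _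
  have h1 : Real.sqrt n * Real.sqrt ℓ * Θ ≤ Real.sqrt n * Real.sqrt Λ * Θ := by gcongr
  have h2 : 0 ≤ Real.sqrt n * Real.sqrt Λ * (σ * Real.sqrt s) := by positivity
  have h3 : 0 < κ * U := by positivity
  rw [e2]
  calc _ = 10 * (Real.sqrt m * Real.sqrt (2 * ℓ) * Θ) +
        4 * (Real.sqrt n * Real.sqrt Λ * (σ * Real.sqrt s)) := by ring
    _ = 10 * (Real.sqrt n * Real.sqrt ℓ * Θ) +
        4 * (Real.sqrt n * Real.sqrt Λ * (σ * Real.sqrt s)) := by rw [e1]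
    _ ≤ _ := by linarith

theorem error_le {U Θ ℓ σ : ℝ} (hU : 0 < U) (hΘ : 0 ≤ Θ) (hσ : 0 < σ) :
    4 * (5 * Real.sqrt (2 * ℓ) * Θ + σ * (2 * Real.sqrt ℓ)) / U ≤
      32 * (Real.sqrt ℓ * (σ + Θ)) / U := by
  refine div_le_div_of_nonneg_right ?_ hU.le
  rw [Real.sqrt_mul (by norm_num)]
  have h1 : Real.sqrt 2 * (Real.sqrt ℓ * Θ) ≤ 3 / 2 * (Real.sqrt ℓ * Θ) :=
    mul_le_mul_of_nonneg_right sqrt_two_le (by positivity)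
  have h2 : 0 ≤ Real.sqrt ℓ * Θ := by positivity
  have h3 : 0 ≤ Real.sqrt ℓ * σ := by positivity
  linarith

/-- Since `κ ≤ n`, the factor `√n` in the condition can be traded for `√κ`, which leaves the signal
of order `√κ * U` that the peak requires. -/
theorem snr_peak {n κ U Θ ℓ Λ σ s : ℝ} (hκn : κ ≤ n) (hκ : 0 < κ) (hU : 0 < U) (hΘ : 0 ≤ Θ)
    (hℓΛ : ℓ ≤ Λ) (hσ : 0 < σ) (hs : 1 ≤ s)
    (h : 200 * (Real.sqrt n * Real.sqrt Λ * (σ * Real.sqrt s + Θ)) ≤ κ * U) :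
    32 * (Real.sqrt ℓ * (σ + Θ)) / U < Real.sqrt κ / 4 := by
  have hn : 0 < Real.sqrt n := Real.sqrt_pos.mpr (hκ.trans_le hκn)
  have hκ' : 0 < Real.sqrt κ := Real.sqrt_pos.mpr hκ
  have h1 : Real.sqrt κ ≤ Real.sqrt n := Real.sqrt_le_sqrt hκn
  have h2 : σ ≤ σ * Real.sqrt s :=
    le_mul_of_one_le_right hσ.le (Real.one_le_sqrt.mpr hs)
  have h3 : Real.sqrt ℓ * (σ + Θ) ≤ Real.sqrt Λ * (σ * Real.sqrt s + Θ) := by gcongr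
  have h4 : κ * U ≤ Real.sqrt n * (Real.sqrt κ * U) := by
    calc κ * U = Real.sqrt κ * (Real.sqrt κ * U) := by
          rw [← mul_assoc, Real.mul_self_sqrt hκ.le]
      _ ≤ _ := mul_le_mul_of_nonneg_right h1 (by positivity)
  have h5 : 200 * (Real.sqrt Λ * (σ * Real.sqrt s + Θ)) ≤ Real.sqrt κ * U := by
    refine le_of_mul_le_mul_left ?_ hn
    linarith
  have h6 : 0 < Real.sqrt κ * U := by positivity
  rw [div_lt_iff₀ hU]
  linarith

theorem rescale_error {κ U Θ ℓ ℓ' σ δ e z : ℝ} (hκ : 0 < κ) (hU : 0 < U) (hΘ : 0 ≤ Θ)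
    (hℓ : ℓ ≤ ℓ') (hσ : 0 < σ) (h : |e - z| ≤ 4 * Real.sqrt κ * δ)
    (hδ : δ ≤ 32 * (Real.sqrt ℓ * (σ + Θ)) / U) :
    |2 * e - 2 * z| / (2 * κ) ≤ 200 * Real.sqrt (ℓ' / (2 * κ)) * (σ / U + Θ / U) := by
  have hκ' : 0 < Real.sqrt κ := Real.sqrt_pos.mpr hκ
  have h1 : |2 * e - 2 * z| / (2 * κ) = |e - z| / κ := by
    rw [← mul_sub, abs_mul, abs_two, mul_div_mul_left _ _ two_ne_zero]
  have h2 : Real.sqrt (ℓ' / (2 * κ)) = Real.sqrt ℓ' / (Real.sqrt 2 * Real.sqrt κ) := by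
    rw [Real.sqrt_div' _ (by positivity), Real.sqrt_mul (by norm_num)]
  have h3 : |e - z| ≤ 4 * Real.sqrt κ * (32 * (Real.sqrt ℓ' * (σ + Θ)) / U) := by
    refine h.trans (mul_le_mul_of_nonneg_left (hδ.trans ?_) (by positivity))
    gcongr
  have h4 : (128 : ℝ) ≤ 200 / Real.sqrt 2 := by
    -- The bounds `4 * √κ` and `32` multiply to 128, and `128 * √2 ≤ 200` fixes the constant `C`.
    rw [le_div_iff₀ (by positivity)]; linarith [sqrt_two_le]
  rw [h1, h2]
  calc |e - z| / κ ≤ 4 * Real.sqrt κ * (32 * (Real.sqrt ℓ' * (σ + Θ)) / U) / κ :=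
        div_le_div_of_nonneg_right h3 hκ.le
    _ = 128 * (Real.sqrt ℓ' / Real.sqrt κ * ((σ + Θ) / U)) := by
        have : κ = Real.sqrt κ * Real.sqrt κ := (Real.mul_self_sqrt hκ.le).symm
        generalize Real.sqrt κ = c at *
        subst this
        field_simp; ring
    _ ≤ 200 / Real.sqrt 2 * (Real.sqrt ℓ' / Real.sqrt κ * ((σ + Θ) / U)) :=
        mul_le_mul_of_nonneg_right h4 (by positivity)
    _ = _ := by field_simp

theorem boundaryDist_eq {n z : ℕ} (hn : Even n) (hz : Even z) (hzn : z < n) :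
    boundaryDist n z = 2 * (min (z / 2) (n / 2 - z / 2) : ℕ) / n := by
  obtain ⟨m, rfl⟩ := hn
  obtain ⟨ζ, rfl⟩ := hz
  have h1 : (m + m) / 2 = m := by omega
  have h2 : (ζ + ζ) / 2 = ζ := by omega
  have h3 : ζ ≤ m := by omega
  rw [boundaryDist, h1, h2]
  congr 1
  push_cast [Nat.cast_sub h3]
  rw [mul_min_of_nonneg _ _ (by norm_num : (0 : ℝ) ≤ 2)]
  congr 1 <;> ring

theorem weightedNorm_pos {p : ℕ} {q : Fin p → unitInterval} (hq : ∀ j, 0 < q j)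
    {θ : EuclideanSpace ℝ (Fin p)} (hθ : θ ≠ 0) : 0 < weightedNorm q θ := by
  obtain ⟨j, hj⟩ : ∃ j, θ j ≠ 0 := by
    by_contra! h
    exact hθ (by ext j; exact h j)
  refine Real.sqrt_pos.mpr (Finset.sum_pos' (fun i _ => mul_nonneg (sq_nonneg _) (q i).2.1)
    ⟨j, Finset.mem_univ j, mul_pos (by positivity) (by exact_mod_cast hq j)⟩)

theorem sparsity_pos {p : ℕ} {θ : EuclideanSpace ℝ (Fin p)} (hθ : θ ≠ 0) : 0 < sparsity θ := by
  obtain ⟨j, hj⟩ : ∃ j, θ j ≠ 0 := by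
    by_contra! h
    exact hθ (by ext j; exact h j)
  exact Finset.card_pos.mpr ⟨j, by simpa using hj⟩

theorem sparsity_le {p : ℕ} (θ : EuclideanSpace ℝ (Fin p)) : sparsity θ ≤ p := by
  exact (Finset.card_filter_le _ _).trans_eq (by simp)

end MissInspect

open MissInspect in
theorem theorem1 :
    ∃ C : ℝ, 0 < C ∧ ∃ C' : ℝ, 0 < C' ∧
      ∀ (n p k z : ℕ) (μ₁ μ₂ θ : EuclideanSpace ℝ (Fin p)) (σ : ℝ) (q : Fin p → unitInterval)
        (opt : (Fin p → Fin (n / 2 - 1) → ℝ) →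
          EuclideanSpace ℝ (Fin p) × EuclideanSpace ℝ (Fin (n / 2 - 1))),
        Even n → Even z → 1 ≤ z → z < n →
        θ = μ₂ - μ₁ → θ ≠ 0 → MissInspect.sparsity θ ≤ k →
        0 < σ → (∀ j, 0 < q j) →
        (∀ T, opt T ∈ MissInspect.argmaxSet
          (2 * σ * Real.sqrt (n * Real.log (p * n))) T) →
        Measurable (fun T => (opt T).1) →
        C' / MissInspect.boundaryDist n z * Real.sqrt (Real.log (p * n) / n) *
            (σ * Real.sqrt k / MissInspect.weightedNorm q θ +
              ‖θ‖ / MissInspect.weightedNorm q θ) ≤ 1 / 2 →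
        MissInspect.changepointLaw n z μ₁ μ₂ σ q
            {d | C * Real.sqrt (Real.log (k * n) / (n * MissInspect.boundaryDist n z)) *
                  (σ / MissInspect.weightedNorm q θ + ‖θ‖ / MissInspect.weightedNorm q θ) <
                |MissInspect.splitEstimator opt (MissInspect.mask d.1 d.2) d.2 - z| /
                  (n * MissInspect.boundaryDist n z)} ≤
          ENNReal.ofReal (22 / n) := by
  refine ⟨200, by norm_num, 200, by norm_num, ?_⟩
  intro n p k z μ₁ μ₂ θ σ q opt hn hz hz1 hzn hθ hθ0 hk hσ hq hopt hmeas hsnr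
  subst hθ
  have hn2 : n = 2 * (n / 2) := by have := Nat.even_iff.mp hn; omega
  have hz2 : z = 2 * (z / 2) := by have := Nat.even_iff.mp hz; omega
  have hζ : 0 < z / 2 := by omega
  have hζm : z / 2 < n / 2 := by omega
  have hτ := boundaryDist_eq hn hz hzn
  have hU := weightedNorm_pos hq hθ0
  have hs1 := sparsity_pos hθ0
  have hsp := sparsity_le (μ₂ - μ₁)
  have hnR : (n : ℝ) = 2 * ((n / 2 : ℕ) : ℝ) := by exact_mod_cast hn2
  have hzR : (z : ℝ) = 2 * ((z / 2 : ℕ) : ℝ) := by exact_mod_cast hz2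
  have hmR : (2 : ℝ) ≤ ((n / 2 : ℕ) : ℝ) := by exact_mod_cast (by omega : 2 ≤ n / 2)
  have hκ : (0 : ℝ) < (min (z / 2) (n / 2 - z / 2) : ℕ) := by
    exact_mod_cast (by omega : 0 < min (z / 2) (n / 2 - z / 2))
  have hκn : ((min (z / 2) (n / 2 - z / 2) : ℕ) : ℝ) ≤ n := by
    exact_mod_cast (by omega : min (z / 2) (n / 2 - z / 2) ≤ n)
  have hn0 : (0 : ℝ) < n := by linarith
  have hsR : (1 : ℝ) ≤ sparsity (μ₂ - μ₁) := by exact_mod_cast hs1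
  have hspR : (sparsity (μ₂ - μ₁) : ℝ) ≤ p := by exact_mod_cast hsp
  have hskR : (sparsity (μ₂ - μ₁) : ℝ) ≤ k := by exact_mod_cast hk
  have hnτ : (n : ℝ) * boundaryDist n z = 2 * (min (z / 2) (n / 2 - z / 2) : ℕ) := by
    rw [hτ]; field_simp
  have hsn : (1 : ℝ) < sparsity (μ₂ - μ₁) * n := by nlinarith
  have hℓ : 0 < Real.log (sparsity (μ₂ - μ₁) * n) := Real.log_pos hsn
  -- The deviation levels use the true sparsity, which is at most both `p` and `k`. No comparison of
  -- `k` with `p` is then needed.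
  have hℓΛ : Real.log (sparsity (μ₂ - μ₁) * n) ≤ Real.log (p * n) :=
    Real.log_le_log (by linarith) (by gcongr)
  have hℓk : Real.log (sparsity (μ₂ - μ₁) * n) ≤ Real.log (k * n) :=
    Real.log_le_log (by linarith) (by gcongr)
  have hΛ : 0 < Real.log (p * n) := hℓ.trans_le hℓΛ
  have hclear := snr_clear_denominators hn0 hκ hU hτ hsnr
  replace hclear : 200 * (Real.sqrt n * Real.sqrt (Real.log (p * n)) *
      (σ * Real.sqrt (sparsity (μ₂ - μ₁)) + ‖μ₂ - μ₁‖)) ≤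
      (min (z / 2) (n / 2 - z / 2) : ℕ) * weightedNorm q (μ₂ - μ₁) := by
    refine le_trans ?_ hclear
    gcongr
  set s := sparsity (μ₂ - μ₁) with hs
  have hsnr₁ := snr_alignment hnR (by linarith) hκ hU (norm_nonneg _) hℓΛ hσ hclear
  have herr := error_le (ℓ := Real.log (s * n)) hU (norm_nonneg (μ₂ - μ₁)) hσ
  have hsnr₂ := herr.trans_lt (snr_peak hκn hκ hU (norm_nonneg _) hℓΛ hσ hsR hclear)
  have hx : 0 ≤ Real.sqrt (2 * Real.log (s * n)) := Real.sqrt_nonneg _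
  have hy₁ : 0 < 2 * Real.sqrt (Real.log (p * n)) := by positivity
  have hy₂ : 0 < 2 * Real.sqrt (Real.log (s * n)) := by positivity
  obtain ⟨hb₁, hb₂⟩ := splitLaw_not_countsClose_le (m := n / 2) (z := z / 2) μ₁ μ₂ (σ := σ) q hq hx
    (Finset.univ.filter fun j => (μ₂ - μ₁) j ≠ 0)
  have hb₃ := splitLaw_cusumNoise_le (m := n / 2) (z := z / 2) μ₁ μ₂ q hσ hy₁
  have hb₄ := splitLaw_project_cusumNoise_le (m := n / 2) (z := z / 2) μ₁ μ₂ q hσ hy₂ hmeas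
    fun T => by simpa using (hopt T).1.1
  -- The levels are chosen so that every tail is of order `(s * n) ^ (-2)` or `(p * n) ^ (-2)`,
  -- which outweighs the union bounds.
  have ex : Real.exp (-Real.sqrt (2 * Real.log (s * n)) ^ 2) = (((s : ℝ) * n) ^ 2)⁻¹ := by
    rw [Real.sq_sqrt (by positivity), exp_neg_two_mul_log (by linarith)]
  have ey : ∀ a : ℝ, 1 < a →
      Real.exp (-((2 * Real.sqrt (Real.log a)) ^ 2 / 2)) = (a ^ 2)⁻¹ := by
    intro a ha
    rw [mul_pow, Real.sq_sqrt (Real.log_pos ha).le, ← exp_neg_two_mul_log (by linarith)]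
    ring_nf
  have hpn : (1 : ℝ) < p * n := hsn.trans_le (by gcongr)
  rw [ex] at hb₁ hb₂
  rw [ey _ hpn] at hb₃
  rw [ey _ hsn] at hb₄
  have hcard : (Finset.univ.filter fun j => (μ₂ - μ₁) j ≠ 0).card = s := rfl
  rw [hcard] at hb₁ hb₂
  -- The failure event is included in the preimage of the bad events. `Measure.le_map_apply` holds
  -- for every set, so no measurability of the estimator is required.
  refine le_trans (le_trans (measure_mono ?_)
    (Measure.le_map_apply (measurePreserving_changepointLaw hn hz μ₁ μ₂ σ q).measurable.aemeasurable
      _)) (le_trans (le_of_eq (congrFun (congrArg _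
        (measurePreserving_changepointLaw hn hz μ₁ μ₂ σ q).map_eq) _))
      (le_trans ((measure_union_le _ _).trans (add_le_add ((measure_union_le _ _).trans
        (add_le_add ((measure_union_le _ _).trans (add_le_add hb₁ hb₂)) hb₃)) hb₄)) ?_))
  swap
  · rw [← ENNReal.ofReal_add (by positivity) (by positivity),
      ← ENNReal.ofReal_add (by positivity) (by positivity),
      ← ENNReal.ofReal_add (by positivity) (by positivity)]
    exact ENNReal.ofReal_le_ofReal
      (tail_sum_le (by linarith) (by linarith) hsR (hsR.trans hspR))
  · intro d hd
    by_contra hgood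
    simp only [Set.mem_preimage, Set.mem_union, Set.mem_iUnion, Set.mem_ofPred_eq, not_or,
      not_exists, not_and, not_not, not_lt, Finset.mem_filter, Finset.mem_univ, true_and]
      at hgood
    obtain ⟨⟨⟨g₁, g₂⟩, g₃⟩, g₄⟩ := hgood
    have hmain := abs_median_peakSet_project_sub_le hζ hζm hq hx (by positivity)
      (hopt _) g₁ g₂ g₃ g₄ (by
        rw [Real.sqrt_mul hn0.le]
        have : Real.sqrt ((n / 2 : ℕ) : ℝ) ≤ Real.sqrt n := Real.sqrt_le_sqrt (by linarith)
        calc Real.sqrt ((n / 2 : ℕ) : ℝ) * (σ * (2 * Real.sqrt (Real.log (p * n))))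
            ≤ Real.sqrt n * (σ * (2 * Real.sqrt (Real.log (p * n)))) := by gcongr
          _ = _ := by ring) le_rfl hU hsnr₁ hsnr₂
    have hfin := rescale_error hκ hU (norm_nonneg _) hℓk hσ hmain herr
    rw [← hzR, ← hnτ] at hfin
    exact absurd hd (not_lt.mpr hfin)
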